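/- Let $\mathbb R_+$ be the set of nonnegative reals with the operations $a\oplus b=\max(a,b)$ and $a\otimes b=ab$; matrix products, powers $A^t$ ($A^0=I$) and matrix-vector products are taken over this semiring. For $A\in\mathbb R_+^{n\times n}$ let $D(A)$ be the digraph on $\{1,\dots,n\}$ with edges $(i,j)$, $a_{ij}\ne 0$. A cycle of $D(A)$ is a closed path with at least one edge, its weight is the product of the entries $a_{ij}$ along it, and its geometric mean is the $k$-th root of its weight, $k$ being its number of edges. For each strongly connected component of $D(A)$, its critical digraph consists of the nodes and edges on those cycles in the component whose geometric mean is the largest one in this component (it is empty if the component has no cycle). The cyclicity of a strongly connected digraph is the greatest common divisor of the lengths of its simple cycles. Let $\gamma\ge 1$ be the least common multiple of the cyclicities of all strongly connected components of the critical digraphs of all components of $D(A)$ ($\gamma=1$ if $D(A)$ is acyclic). The matrix $A$ is called orbit periodic if for each $y\in\mathbb R_+^n$ there is $\lambda(y)\in\mathbb R_+$ such that $A^{t+\gamma}\otimes y=\lambda(y)^{\gamma}\,(A^t\otimes y)$ for all sufficiently large $t$ (here $\lambda(y)^\gamma$ is the usual power of the number $\lambda(y)$). **Corollary.** Given $A\in\mathbb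 R_+^{n\times n}$, it takes no more than $O(n^4\log n)$ operations to verify whether $A$ is orbit periodic or not. That is, there are a single program $P$ and a constant $K$ such that for all $n\ge 0$ and all $A\in\mathbb R_+^{n\times n}$, the program $P$, given $n$ and $A$, stops with the correct answer to the question whether $A$ is orbit periodic, and for $n\ge 2$ it does so after at most $K n^4\log n$ operations. Programs are built by sequencing, if-then-else and while loops for a random access machine with index registers and with two-dimensional arrays of natural numbers and of nonnegative reals, whose entries are addressed by index registers. Each of the following counts as one operation: setting an index register to $0$, changing it by $\pm1$ (decrementing $0$ gives $0$), copying it, moving a natural number between a register and an array entry, testing $=$ or $<$ between index registers; setting a real array entry to $0$ or $1$, copying it, the product or the maximum of two real entries, testing $\le$ between two real entries. -/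

import Mathlib

open scoped NNReal

namespace MaxAlg

/-! ### Max algebra over the nonnegative reals

In `ℝ≥0` the supremum over a finite index set is the maximum, and it is `0` (the zero of the
semiring) over the empty set. -/

section Algebra

variable {n : ℕ}

/-- Max-algebraic matrix product, `(A ⊗ B) i j = max_k A i k * B k j`. -/
noncomputable def mul (A B : Matrix (Fin n) (Fin n) ℝ≥0) : Matrix (Fin n) (Fin n) ℝ≥0 :=
  fun i j => Finset.univ.sup fun k => A i k * B k j

/-- Max-algebraic powers, starting from the identity matrix. -/
noncomputable def pow (A : Matrix (Fin n) (Fin n) ℝ≥0) : ℕ → Matrix (Fin n) (Fin n) ℝ≥0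
  | 0 => 1
  | t + 1 => mul (pow A t) A

/-- Max-algebraic product of a matrix and a vector, `(A ⊗ y) i = max_j A i j * y j`. -/
noncomputable def mulVec (A : Matrix (Fin n) (Fin n) ℝ≥0) (y : Fin n → ℝ≥0) : Fin n → ℝ≥0 :=
  fun i => Finset.univ.sup fun j => A i j * y j

/-! ### Associated digraph, maximum cycle geometric mean, critical digraph -/

/-- Edges of the digraph associated with `A`. -/
def Edge (A : Matrix (Fin n) (Fin n) ℝ≥0) (i j : Fin n) : Prop := A i j ≠ 0

/-- `c 0, c 1, …, c k = c 0` is a cycle (closed path) with `k ≥ 1` edges in the digraph whose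
edge relation is `E`. Repeated nodes are allowed; values of `c` beyond `k` are irrelevant. -/
def IsCycle (E : Fin n → Fin n → Prop) (k : ℕ) (c : ℕ → Fin n) : Prop :=
  0 < k ∧ c k = c 0 ∧ ∀ t < k, E (c t) (c (t + 1))

/-- Weight of the path `c 0, c 1, …, c k`. -/
noncomputable def weight (A : Matrix (Fin n) (Fin n) ℝ≥0) (k : ℕ) (c : ℕ → Fin n) : ℝ≥0 :=
  ∏ t ∈ Finset.range k, A (c t) (c (t + 1))

/-- The geometric mean `w(c)^(1/k)` of a cycle with `k` edges. -/
noncomputable def geomMean (A : Matrix (Fin n) (Fin n) ℝ≥0) (k : ℕ) (c : ℕ → Fin n) : ℝ≥0 :=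
  weight A k c ^ (1 / (k : ℝ))

/-- Maximum cycle geometric mean: the maximum over the cycles with at most `n` edges. These have
finitely many geometric means, so the supremum is a maximum; it is `0` if there is no cycle. -/
noncomputable def mcgm (A : Matrix (Fin n) (Fin n) ℝ≥0) : ℝ≥0 :=
  sSup {x | ∃ k c, k ≤ n ∧ IsCycle (Edge A) k c ∧ x = geomMean A k c}

/-- Edges of the critical digraph of `A`: the edges on cycles that attain the maximum cycle
geometric mean. -/
def CritEdge (A : Matrix (Fin n) (Fin n) ℝ≥0) (i j : Fin n) : Prop :=
  ∃ k c, IsCycle (Edge A) k c ∧ geomMean A k c = mcgm A ∧ ∃ t < k, c t = i ∧ c (t + 1) = j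

/-- `i` and `j` lie in the same strongly connected component of the digraph `E`. -/
def SameComp (E : Fin n → Fin n → Prop) (i j : Fin n) : Prop :=
  Relation.ReflTransGen E i j ∧ Relation.ReflTransGen E j i

open Classical in
/-- Cyclicity of the strongly connected component of the node `i` in the digraph `E`: the g.c.d.
of the lengths of its simple cycles (a simple cycle has at most `n` edges). -/
noncomputable def compCyclicity (E : Fin n → Fin n → Prop) (i : Fin n) : ℕ :=
  ((Finset.Icc 1 n).filter fun k =>
    ∃ c, IsCycle E k c ∧ Set.InjOn c (Set.Iio k) ∧ SameComp E i (c 0)).gcd id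

open Classical in
/-- Cyclicity of a digraph in which every edge lies on a cycle: the l.c.m. of the cyclicities of
the strongly connected components (`1` if there is no edge). -/
noncomputable def cyclicity (E : Fin n → Fin n → Prop) : ℕ :=
  (Finset.univ.filter fun i => ∃ j, E i j).lcm (compCyclicity E)

open Classical in
/-- `A` restricted to the strongly connected component of the node `m` of its digraph; all the
other entries are replaced by `0`. -/
noncomputable def component (A : Matrix (Fin n) (Fin n) ℝ≥0) (m : Fin n) :
    Matrix (Fin n) (Fin n) ℝ≥0 :=
  fun i j => if SameComp (Edge A) m i ∧ SameComp (Edge A) m j then A i j else 0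

/-- The joint cyclicity (l.c.m.) of the critical digraphs of all components of the digraph of
`A`. -/
noncomputable def jointCyclicity (A : Matrix (Fin n) (Fin n) ℝ≥0) : ℕ :=
  Finset.univ.lcm fun m => cyclicity (CritEdge (component A m))

/-- `A` is orbit periodic: every orbit `A^t ⊗ y` is ultimately linear periodic. -/
def OrbitPeriodic (A : Matrix (Fin n) (Fin n) ℝ≥0) : Prop :=
  ∀ y : Fin n → ℝ≥0, ∃ rate : ℝ≥0, ∃ T : ℕ, ∀ t ≥ T,
    mulVec (pow A (t + jointCyclicity A)) y = rate ^ jointCyclicity A • mulVec (pow A t) y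

end Algebra

/-! ### A random access machine over the nonnegative reals

A program is a fixed finite text, the same for all inputs. It works on index registers (natural
numbers) and on two unbounded families of two-dimensional arrays, one with natural numbers and
one with nonnegative reals as entries. Natural numbers can only be copied, compared and changed
by one, so that those that occur in a run exceed the order of the matrix by at most the number of
steps. Nonnegative reals can only be copied, compared, multiplied and maximized; there are no
real constants but `0` and `1`, no roots, no rounding and no conversion between the two sorts. -/

/-- Contents of the memory. -/
structure Store where
  /-- index registers -/
  reg : ℕ → ℕ
  /-- arrays of natural numbers: name of the array, row, column -/
  nat : ℕ → ℕ → ℕ → ℕ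
  /-- arrays of nonnegative reals: name of the array, row, column -/
  real : ℕ → ℕ → ℕ → ℝ≥0

/-- The reference `⟨a, x, y⟩` is to the entry of the array `a` whose row and column are the
contents of the index registers `x` and `y`. -/
structure Ref where
  arr : ℕ
  row : ℕ
  col : ℕ

namespace Store

def getNat (s : Store) (p : Ref) : ℕ := s.nat p.arr (s.reg p.row) (s.reg p.col)

def getReal (s : Store) (p : Ref) : ℝ≥0 := s.real p.arr (s.reg p.row) (s.reg p.col)

def setReg (s : Store) (x v : ℕ) : Store :=
  { s with reg := fun z => if z = x then v else s.reg z }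

def setNat (s : Store) (p : Ref) (v : ℕ) : Store :=
  { s with nat := fun a i j =>
      if a = p.arr ∧ i = s.reg p.row ∧ j = s.reg p.col then v else s.nat a i j }

noncomputable def setReal (s : Store) (p : Ref) (v : ℝ≥0) : Store :=
  { s with real := fun a i j =>
      if a = p.arr ∧ i = s.reg p.row ∧ j = s.reg p.col then v else s.real a i j }

end Store

/-- Elementary operations. -/
inductive Instr where
  | zero (x : ℕ)
  | succ (x : ℕ)
  | pred (x : ℕ)
  | copy (x y : ℕ)
  | load (x : ℕ) (p : Ref)
  | store (p : Ref) (x : ℕ)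
  | realZero (p : Ref)
  | realOne (p : Ref)
  | realCopy (p q : Ref)
  | realMul (p q r : Ref)
  | realMax (p q r : Ref)

/-- Effect of an elementary operation; the first argument is the destination. -/
noncomputable def Instr.apply : Instr → Store → Store
  | zero x, s => s.setReg x 0
  | succ x, s => s.setReg x (s.reg x + 1)
  | pred x, s => s.setReg x (s.reg x - 1)
  | copy x y, s => s.setReg x (s.reg y)
  | load x p, s => s.setReg x (s.getNat p)
  | store p x, s => s.setNat p (s.reg x)
  | realZero p, s => s.setReal p 0
  | realOne p, s => s.setReal p 1
  | realCopy p q, s => s.setReal p (s.getReal q)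
  | realMul p q r, s => s.setReal p (s.getReal q * s.getReal r)
  | realMax p q r, s => s.setReal p (max (s.getReal q) (s.getReal r))

/-- Elementary tests. -/
inductive Test where
  | eq (x y : ℕ)
  | lt (x y : ℕ)
  | realLe (p q : Ref)

def Test.Holds : Test → Store → Prop
  | eq x y, s => s.reg x = s.reg y
  | lt x y, s => s.reg x < s.reg y
  | realLe p q, s => s.getReal p ≤ s.getReal q

/-- Programs. -/
inductive Prog where
  | op (c : Instr)
  | seq (P Q : Prog)
  | ite (b : Test) (P Q : Prog)
  | while (b : Test) (P : Prog)

/-- `Exec P s t s'`: the program `P`, started in the store `s`, stops in the store `s'` after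
exactly `t` operations. Each execution of an elementary operation and each evaluation of an
elementary test counts as one operation. -/
inductive Exec : Prog → Store → ℕ → Store → Prop
  | op (c : Instr) (s : Store) : Exec (.op c) s 1 (c.apply s)
  | seq {P Q : Prog} {s₀ s₁ s₂ : Store} {t u : ℕ} :
      Exec P s₀ t s₁ → Exec Q s₁ u s₂ → Exec (.seq P Q) s₀ (t + u) s₂
  | iteTrue {b : Test} {P Q : Prog} {s₀ s₁ : Store} {t : ℕ} :
      b.Holds s₀ → Exec P s₀ t s₁ → Exec (.ite b P Q) s₀ (1 + t) s₁
  | iteFalse {b : Test} {P Q : Prog} {s₀ s₁ : Store} {t : ℕ} :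
      ¬ b.Holds s₀ → Exec Q s₀ t s₁ → Exec (.ite b P Q) s₀ (1 + t) s₁
  | whileTrue {b : Test} {P : Prog} {s₀ s₁ s₂ : Store} {t u : ℕ} :
      b.Holds s₀ → Exec P s₀ t s₁ → Exec (.while b P) s₁ u s₂ →
      Exec (.while b P) s₀ (1 + t + u) s₂
  | whileFalse {b : Test} {P : Prog} {s : Store} :
      ¬ b.Holds s → Exec (.while b P) s 1 s

/-- The initial store for the input `A`: the index register `0` holds the order `n`, the real
array `0` holds the entries of `A` in its rows and columns `0, …, n - 1`, and everything else is
`0`. -/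
noncomputable def inputStore {n : ℕ} (A : Matrix (Fin n) (Fin n) ℝ≥0) : Store where
  reg x := if x = 0 then n else 0
  nat _ _ _ := 0
  real a i j := if h : a = 0 ∧ i < n ∧ j < n then A ⟨i, h.2.1⟩ ⟨j, h.2.2⟩ else 0

/-- A final store gives the answer "yes" if the index register `0` holds `1`, and "no" if it
holds `0`. -/
def Store.Answers (s : Store) (claim : Prop) : Prop :=
  (claim ∧ s.reg 0 = 1) ∨ (¬ claim ∧ s.reg 0 = 0)

end MaxAlg

open scoped NNReal

namespace MaxAlg

/-! ### Walks and matrix powers -/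

section Walks

variable {n : ℕ} {A : Matrix (Fin n) (Fin n) ℝ≥0}

/-! Write γ for `jointCyclicity A` and λ(v) for `lam A v`, the maximum cycle geometric mean of the
component of v. The entries of A^t are maximal weights of walks with t edges. If t runs through a
residue class r modulo γ, the entry i, j is ultimately W·ρ^t, where ρ = `rate A i j r` is the
largest λ(v) over nodes v on walks from i to j with length in that class (`exists_eventually_eq`).
Walks through a critical node with λ = ρ can be shortened modulo γ without loss of normalized weight
and lengthened by critical closed walks; all other walks are of smaller order.

Hence an orbit is ultimately periodic with a common factor exactly when the dominant rates over the
support of the starting vector coincide in all rows and residue classes where they do not vanish. It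
is enough to test supports with at most two elements, because two columns that dominate at two
different places can be compared jointly (`orbitPeriodic_iff_ratesAgree`).

Two obstacles to an algorithm remain: the machine has no roots, and γ is a least common multiple
whose residues are too many to enumerate. For the first, λ is replaced by its power with exponent
n!, which `lamHat` attains at suitable critical nodes. For the second, only rows i on a cycle of
some length L ≤ n are inspected. In such a row, the existence of a walk of large length t through a
given node depends only on t modulo L, so `best A t i j` is already the n!-th power of the rate once
t ≥ 2n² (`best_eq_rate_pow`). Any n consecutive large lengths therefore show everything, and every
nonzero joint rate occurs in such a row (`exists_recurrent_row`).

The pairs (`reach`, `best`) multiply by a product rule (`reach_add`, `best_add`). With 3n squarings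
the program gets to length 8^n ≥ 2n², then it passes through n consecutive lengths and compares all
values with one recorded value per pair of columns. That is O(n) matrix products and O(n) checks at
O(n³) each, and `lamHat` also costs O(n⁴), so the logarithm in the bound is not needed. -/

theorem mul_assoc' (A B C : Matrix (Fin n) (Fin n) ℝ≥0) : mul (mul A B) C = mul A (mul B C) := by
  funext i j
  simp only [mul, NNReal.finset_sup_mul, NNReal.mul_finset_sup]
  rw [Finset.sup_comm]
  simp only [mul_assoc]

theorem one_mul' (A : Matrix (Fin n) (Fin n) ℝ≥0) : mul 1 A = A := by
  funext i j
  refine le_antisymm (Finset.sup_le fun k _ => ?_) ?_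
  · by_cases h : i = k
    · subst h; simp
    · simp [Matrix.one_apply_ne h]
  · refine le_trans ?_ (Finset.le_sup (f := fun k => (1 : Matrix _ _ ℝ≥0) i k * A k j)
      (Finset.mem_univ i))
    simp

theorem mul_one' (A : Matrix (Fin n) (Fin n) ℝ≥0) : mul A 1 = A := by
  funext i j
  refine le_antisymm (Finset.sup_le fun k _ => ?_) ?_
  · by_cases h : k = j
    · subst h; simp
    · simp [Matrix.one_apply_ne h]
  · refine le_trans ?_ (Finset.le_sup (f := fun k => A i k * (1 : Matrix _ _ ℝ≥0) k j)
      (Finset.mem_univ j))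
    simp

theorem pow_one' (A : Matrix (Fin n) (Fin n) ℝ≥0) : pow A 1 = A := one_mul' A

theorem pow_add' (A : Matrix (Fin n) (Fin n) ℝ≥0) (s t : ℕ) :
    pow A (s + t) = mul (pow A s) (pow A t) := by
  induction t with
  | zero => exact (mul_one' _).symm
  | succ t ih => rw [← add_assoc, pow, ih, mul_assoc', ← pow]

theorem le_mul (A B : Matrix (Fin n) (Fin n) ℝ≥0) (i u j : Fin n) :
    A i u * B u j ≤ mul A B i j :=
  Finset.le_sup (f := fun k => A i k * B k j) (Finset.mem_univ u)

theorem exists_mul_eq (A B : Matrix (Fin n) (Fin n) ℝ≥0) (i j : Fin n) :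
    ∃ u, mul A B i j = A i u * B u j := by
  obtain ⟨u, -, hu⟩ := Finset.exists_mem_eq_sup Finset.univ ⟨i, Finset.mem_univ i⟩
    (fun k => A i k * B k j)
  exact ⟨u, hu⟩

theorem le_pow_add (A : Matrix (Fin n) (Fin n) ℝ≥0) (s t : ℕ) (i u j : Fin n) :
    pow A s i u * pow A t u j ≤ pow A (s + t) i j := by
  rw [pow_add']; exact le_mul _ _ _ _ _

theorem exists_pow_add_eq (A : Matrix (Fin n) (Fin n) ℝ≥0) (s t : ℕ) (i j : Fin n) :
    ∃ u, pow A (s + t) i j = pow A s i u * pow A t u j := by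
  rw [pow_add']; exact exists_mul_eq _ _ _ _

theorem pow_add_ne_zero {s t : ℕ} {i u j : Fin n} (h₁ : pow A s i u ≠ 0) (h₂ : pow A t u j ≠ 0) :
    pow A (s + t) i j ≠ 0 :=
  ((mul_pos h₁.bot_lt h₂.bot_lt).trans_le (le_pow_add A s t i u j)).ne'

theorem pow_mul_ne_zero {s : ℕ} {i : Fin n} (h : pow A s i i ≠ 0) (m : ℕ) :
    pow A (m * s) i i ≠ 0 := by
  induction m with
  | zero => simp [pow]
  | succ m ih => rw [Nat.succ_mul]; exact pow_add_ne_zero ih h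

theorem weight_add (A : Matrix (Fin n) (Fin n) ℝ≥0) (s t : ℕ) (c : ℕ → Fin n) :
    weight A (s + t) c = weight A s c * weight A t fun m => c (s + m) := by
  simp only [weight, Finset.prod_range_add, add_assoc]

theorem weight_le_pow (A : Matrix (Fin n) (Fin n) ℝ≥0) (t : ℕ) (c : ℕ → Fin n) :
    weight A t c ≤ pow A t (c 0) (c t) := by
  induction t with
  | zero => simp [weight, pow]
  | succ t ih =>
    rw [weight, Finset.prod_range_succ, pow]
    exact le_trans (mul_le_mul_left ih _) (le_mul _ _ _ _ _)

theorem exists_weight_eq {t : ℕ} {i j : Fin n} (h : pow A t i j ≠ 0) :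
    ∃ c : ℕ → Fin n, c 0 = i ∧ c t = j ∧ weight A t c = pow A t i j := by
  induction t generalizing j with
  | zero =>
    have hij : i = j := by
      by_contra hne
      exact h (by rw [pow]; exact Matrix.one_apply_ne hne)
    subst hij
    exact ⟨fun _ => i, rfl, rfl, by simp [weight, pow]⟩
  | succ t ih =>
    obtain ⟨u, hu⟩ := exists_mul_eq (pow A t) A i j
    have hu' : pow A (t + 1) i j = pow A t i u * A u j := hu
    rw [hu'] at h
    obtain ⟨c, h0, ht, hc⟩ := ih (left_ne_zero_of_mul h)
    refine ⟨fun m => if m ≤ t then c m else j, by simp [h0], by simp, ?_⟩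
    rw [hu', weight, Finset.prod_range_succ, ← hc, weight]
    congr 1
    · refine Finset.prod_congr rfl fun m hm => ?_
      have := Finset.mem_range.1 hm
      rw [if_pos this.le, if_pos (by omega)]
    · simp [ht]

/-- A part of a walk of maximal weight has maximal weight. -/
theorem pow_eq_of_optimal {s t : ℕ} {c : ℕ → Fin n}
    (hc : weight A (s + t) c = pow A (s + t) (c 0) (c (s + t))) :
    pow A (s + t) (c 0) (c (s + t)) =
      pow A s (c 0) (c s) * pow A t (c s) (c (s + t)) := by
  refine le_antisymm ?_ (le_pow_add _ _ _ _ _ _)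
  rw [← hc, weight_add]
  exact mul_le_mul' (weight_le_pow _ _ _) (weight_le_pow A t fun m => c (s + m))

theorem pow_eq_of_optimal₃ {s t r : ℕ} {c : ℕ → Fin n}
    (hc : weight A (s + t + r) c = pow A (s + t + r) (c 0) (c (s + t + r))) :
    pow A (s + t + r) (c 0) (c (s + t + r)) =
      pow A s (c 0) (c s) * pow A t (c s) (c (s + t)) *
        pow A r (c (s + t)) (c (s + t + r)) := by
  refine le_antisymm ?_ ((mul_le_mul_left (le_pow_add _ _ _ _ _ _) _).trans
    (le_pow_add _ _ _ _ _ _))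
  rw [← hc, weight_add, weight_add]
  exact mul_le_mul' (mul_le_mul' (weight_le_pow _ _ _) (weight_le_pow A t fun m => c (s + m)))
    (weight_le_pow A r fun m => c (s + t + m))

/-- A long walk contains a short closed walk whose length is a multiple of `g`. -/
theorem exists_closed_split {g t : ℕ} (hg : 0 < g) (ht : n * g ≤ t) {i j : Fin n}
    (h : pow A t i j ≠ 0) :
    ∃ (u : Fin n) (a b d : ℕ), a + b + d = t ∧ 0 < b ∧ g ∣ b ∧ b ≤ n * g ∧
      pow A t i j = pow A a i u * pow A b u u * pow A d u j := by
  obtain ⟨c, rfl, rfl, hc⟩ := exists_weight_eq h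
  -- Pigeonhole: over the n·g + 1 times 0, …, n·g, the pair (node, time modulo g) takes at most n·g
  -- values. A repetition gives a closed subwalk whose length is divisible by g.
  obtain ⟨x, hx, y, hy, hxy, he⟩ := Finset.exists_ne_map_eq_of_card_lt_of_maps_to
    (s := Finset.range (n * g + 1)) (t := (Finset.univ : Finset (Fin n)) ×ˢ Finset.range g)
    (f := fun m => (c m, m % g)) (by simp)
    (fun m _ => by
      simp only [Finset.coe_product, Set.mem_prod]
      exact ⟨by simp, by simpa using Nat.mod_lt _ hg⟩)
  wlog hlt : x < y generalizing x y
  · exact this y hy x hx hxy.symm he.symm (by omega)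
  rw [Finset.mem_range] at hx hy
  obtain ⟨b, rfl⟩ := Nat.exists_eq_add_of_lt hlt
  obtain ⟨d, rfl⟩ := Nat.exists_eq_add_of_le (show x + b + 1 ≤ t by omega)
  simp only [Prod.mk.injEq] at he
  refine ⟨c x, x, b + 1, d, by omega, by omega, ?_, by omega, ?_⟩
  · have h2 : x ≡ x + (b + 1) [MOD g] := he.2
    have h3 : x + 0 ≡ x + (b + 1) [MOD g] := by simpa using h2
    exact (Nat.modEq_zero_iff_dvd.1 (Nat.ModEq.add_left_cancel' x h3).symm)
  · have := pow_eq_of_optimal₃ (s := x) (t := b + 1) (r := d) (c := c) (by simpa [add_assoc] using hc)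
    rw [add_assoc x b 1] at he
    rw [← he.1] at this
    simpa [add_assoc] using this

theorem reflTransGen_iff {i j : Fin n} :
    Relation.ReflTransGen (Edge A) i j ↔ ∃ t, pow A t i j ≠ 0 := by
  constructor
  · intro h
    induction h with
    | refl => exact ⟨0, by simp [pow]⟩
    | tail _ h2 ih =>
      obtain ⟨t, ht⟩ := ih
      exact ⟨t + 1, pow_add_ne_zero ht (by rw [pow_one']; exact h2)⟩
  · rintro ⟨t, ht⟩
    induction t generalizing j with
    | zero =>
      have hij : i = j := by
        by_contra hne
        exact ht (by rw [pow]; exact Matrix.one_apply_ne hne)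
      exact hij ▸ .refl
    | succ t ih =>
      obtain ⟨u, hu⟩ := exists_mul_eq (pow A t) A i j
      rw [pow, hu] at ht
      exact (ih (left_ne_zero_of_mul ht)).tail (right_ne_zero_of_mul ht)

theorem sameComp_iff {i j : Fin n} :
    SameComp (Edge A) i j ↔ (∃ s, pow A s i j ≠ 0) ∧ ∃ t, pow A t j i ≠ 0 := by
  rw [SameComp, reflTransGen_iff, reflTransGen_iff]

theorem SameComp.symm {E : Fin n → Fin n → Prop} {i j : Fin n} (h : SameComp E i j) :
    SameComp E j i := ⟨h.2, h.1⟩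

theorem SameComp.trans {E : Fin n → Fin n → Prop} {i j k : Fin n} (h : SameComp E i j)
    (h' : SameComp E j k) : SameComp E i k := ⟨h.1.trans h'.1, h'.2.trans h.2⟩

theorem component_eq {u v : Fin n} (h : SameComp (Edge A) u v) : component A u = component A v := by
  have : ∀ k, SameComp (Edge A) u k ↔ SameComp (Edge A) v k := fun k =>
    ⟨fun h' => h.symm.trans h', fun h' => h.trans h'⟩
  funext i j
  classical exact if_congr (and_congr (this i) (this j)) rfl rfl

theorem isCycle_iff {k : ℕ} {c : ℕ → Fin n} :
    IsCycle (Edge A) k c ↔ 0 < k ∧ c k = c 0 ∧ weight A k c ≠ 0 := by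
  simp only [IsCycle, weight, Finset.prod_ne_zero_iff, Finset.mem_range, Edge]

theorem sameComp_of_cycle {k : ℕ} {c : ℕ → Fin n} (h : IsCycle (Edge A) k c) {t : ℕ}
    (ht : t ≤ k) : SameComp (Edge A) (c 0) (c t) := by
  have hw := (isCycle_iff.1 h).2.2
  obtain ⟨r, rfl⟩ := Nat.exists_eq_add_of_le ht
  rw [weight_add] at hw
  refine sameComp_iff.2 ⟨⟨t, ?_⟩, r, ?_⟩
  · exact ((left_ne_zero_of_mul hw).bot_lt.trans_le (weight_le_pow _ _ _)).ne'
  · have := ((right_ne_zero_of_mul hw).bot_lt.trans_le (weight_le_pow _ _ _)).ne'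
    simpa [h.2.1] using this

theorem weight_component {m : Fin n} {k : ℕ} {c : ℕ → Fin n} (h : IsCycle (Edge A) k c)
    (hm : SameComp (Edge A) m (c 0)) : weight (component A m) k c = weight A k c := by
  refine Finset.prod_congr rfl fun t ht => ?_
  have := Finset.mem_range.1 ht
  exact if_pos ⟨hm.trans (sameComp_of_cycle h this.le), hm.trans (sameComp_of_cycle h this)⟩

theorem isCycle_component_iff {m : Fin n} {k : ℕ} {c : ℕ → Fin n} :
    IsCycle (Edge (component A m)) k c ↔
      IsCycle (Edge A) k c ∧ SameComp (Edge A) m (c 0) := by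
  constructor
  · rintro ⟨hk, hc, h⟩
    have h' : ∀ t < k, SameComp (Edge A) m (c t) ∧ Edge A (c t) (c (t + 1)) := by
      intro t ht
      have := h t ht
      unfold Edge component at this
      split_ifs at this with h1
      · exact ⟨h1.1, this⟩
      · exact absurd rfl this
    exact ⟨⟨hk, hc, fun t ht => (h' t ht).2⟩, (h' 0 hk).1⟩
  · rintro ⟨h, hm⟩
    refine ⟨h.1, h.2.1, fun t ht => ?_⟩
    have : component A m (c t) (c (t + 1)) = A (c t) (c (t + 1)) :=
      if_pos ⟨hm.trans (sameComp_of_cycle h ht.le), hm.trans (sameComp_of_cycle h ht)⟩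
    rw [Edge, this]
    exact h.2.2 t ht

end Walks

/-! ### Maximum cycle geometric means of the components -/

section Components

variable {n : ℕ} {A : Matrix (Fin n) (Fin n) ℝ≥0}

/-- The maximum cycle geometric mean of the component of the node `v`. -/
noncomputable def lam (A : Matrix (Fin n) (Fin n) ℝ≥0) (v : Fin n) : ℝ≥0 := mcgm (component A v)

/-- The node `v` lies on a critical cycle of its component. -/
def Crit (A : Matrix (Fin n) (Fin n) ℝ≥0) (v : Fin n) : Prop :=
  ∃ j, CritEdge (component A v) v j

theorem lam_eq_of_sameComp {u v : Fin n} (h : SameComp (Edge A) u v) : lam A u = lam A v := by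
  rw [lam, lam, component_eq h]

-- A cycle weighs at most the corresponding diagonal entry of a power, and each nonzero diagonal
-- entry is the weight of a cycle. So the supremum over cycles becomes a finite maximum over
-- diagonal entries.
open Classical in
theorem lam_eq_sup (A : Matrix (Fin n) (Fin n) ℝ≥0) (v : Fin n) :
    lam A v = ((Finset.univ.filter (SameComp (Edge A) v)) ×ˢ Finset.Icc 1 n).sup
      fun p => pow A p.2 p.1 p.1 ^ (1 / (p.2 : ℝ)) := by
  set S := ((Finset.univ.filter (SameComp (Edge A) v)) ×ˢ Finset.Icc 1 n).sup
      fun p => pow A p.2 p.1 p.1 ^ (1 / (p.2 : ℝ)) with hS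
  have hub : S ∈ upperBounds {x | ∃ k c, k ≤ n ∧ IsCycle (Edge (component A v)) k c ∧
      x = geomMean (component A v) k c} := by
    rintro x ⟨k, c, hk, hc, rfl⟩
    obtain ⟨hc, hv⟩ := isCycle_component_iff.1 hc
    refine le_trans ?_ (Finset.le_sup (f := fun p : Fin n × ℕ => pow A p.2 p.1 p.1 ^ (1 / (p.2 : ℝ)))
      (b := (c 0, k)) ?_)
    · rw [geomMean, weight_component hc hv]
      refine NNReal.rpow_le_rpow ?_ (by positivity)
      simpa [hc.2.1] using weight_le_pow A k c
    · simp only [Finset.mem_product, Finset.mem_filter, Finset.mem_univ, true_and, Finset.mem_Icc]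
      exact ⟨hv, hc.1, hk⟩
  refine le_antisymm (csSup_le' hub) (Finset.sup_le ?_)
  rintro ⟨u, k⟩ hp
  simp only [Finset.mem_product, Finset.mem_filter, Finset.mem_univ, true_and,
    Finset.mem_Icc] at hp
  obtain ⟨hu, hk1, hkn⟩ := hp
  by_cases h0 : pow A k u u = 0
  · simp only [h0]
    rw [NNReal.zero_rpow (by positivity)]
    exact zero_le
  · obtain ⟨c, hc0, hck, hw⟩ := exists_weight_eq h0
    have hcyc : IsCycle (Edge A) k c := isCycle_iff.2 ⟨hk1, hck.trans hc0.symm, hw ▸ h0⟩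
    refine le_csSup ⟨S, hub⟩ ⟨k, c, hkn, isCycle_component_iff.2 ⟨hcyc, hc0.symm ▸ hu⟩, ?_⟩
    rw [geomMean, weight_component hcyc (hc0.symm ▸ hu), hw]

/-- The definition of λ only looks at cycles with at most n edges. A longer closed walk splits into
a short closed walk in the same component and a remaining closed walk, to which induction applies.
-/
theorem pow_self_le (A : Matrix (Fin n) (Fin n) ℝ≥0) (k : ℕ) (v : Fin n) :
    pow A k v v ≤ lam A v ^ k := by
  induction k using Nat.strong_induction_on with
  | _ k ih =>
  have short : ∀ b u, 0 < b → b ≤ n → pow A b u u ≤ lam A u ^ b := by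
    intro b u hb hbn
    classical
    have h := Finset.le_sup (f := fun p : Fin n × ℕ => pow A p.2 p.1 p.1 ^ (1 / (p.2 : ℝ)))
      (s := (Finset.univ.filter (SameComp (Edge A) u)) ×ˢ Finset.Icc 1 n) (b := (u, b)) (by
        simp only [Finset.mem_product, Finset.mem_filter, Finset.mem_univ, true_and,
          Finset.mem_Icc]
        exact ⟨⟨.refl, .refl⟩, hb, hbn⟩)
    rw [← lam_eq_sup] at h
    rw [← NNReal.rpow_natCast]
    rw [one_div] at h
    exact (NNReal.rpow_inv_le_iff (by positivity)).1 h
  rcases Nat.eq_zero_or_pos k with rfl | hk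
  · simp [pow]
  by_cases hkn : k ≤ n
  · exact short k v hk hkn
  by_cases h0 : pow A k v v = 0
  · simp [h0]
  obtain ⟨u, a, b, d, rfl, hb, -, hbn, he⟩ :=
    exists_closed_split (g := 1) one_pos (by omega) h0
  rw [he] at h0
  have hau := left_ne_zero_of_mul (left_ne_zero_of_mul h0)
  have huv : SameComp (Edge A) u v := sameComp_iff.2 ⟨⟨d, right_ne_zero_of_mul h0⟩, a, hau⟩
  rw [he, mul_right_comm, show a + b + d = (a + d) + b by omega, pow_add]
  refine mul_le_mul' ((le_pow_add _ _ _ _ _ _).trans (ih (a + d) (by omega))) ?_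
  rw [← lam_eq_of_sameComp huv]
  exact short b u hb (by simpa using hbn)

theorem lam_ne_zero {k : ℕ} {v : Fin n} (hk : 0 < k) (h : pow A k v v ≠ 0) : lam A v ≠ 0 := by
  intro h0
  have := pow_self_le A k v
  rw [h0, zero_pow hk.ne'] at this
  exact h (le_zero_iff.1 this)

theorem geomMean_eq_iff {k : ℕ} (hk : 0 < k) {c : ℕ → Fin n} {x : ℝ≥0} :
    geomMean A k c = x ↔ weight A k c = x ^ k := by
  rw [geomMean, ← NNReal.rpow_natCast, one_div, NNReal.rpow_inv_eq_iff (by positivity)]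

/-- A closed walk that attains the maximum consists of critical nodes. -/
theorem crit_of_pow_eq {b : ℕ} {v : Fin n} (hb : 0 < b) (h0 : lam A v ≠ 0)
    (h : pow A b v v = lam A v ^ b) : Crit A v := by
  obtain ⟨c, hc0, hcb, hw⟩ := exists_weight_eq (h ▸ pow_ne_zero b h0)
  have hcyc : IsCycle (Edge A) b c :=
    isCycle_iff.2 ⟨hb, hcb.trans hc0.symm, by rw [hw, h]; exact pow_ne_zero b h0⟩
  have hv : SameComp (Edge A) v (c 0) := hc0.symm ▸ ⟨.refl, .refl⟩
  refine ⟨c 1, b, c, isCycle_component_iff.2 ⟨hcyc, hv⟩, ?_, 0, hb, hc0, rfl⟩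
  rw [geomMean_eq_iff hb, weight_component hcyc hv, hw, h, lam]

/-- The maximum is attained in a component with a cycle. -/
theorem exists_attained (A : Matrix (Fin n) (Fin n) ℝ≥0) (v : Fin n) :
    ∃ u k, SameComp (Edge A) v u ∧ 0 < k ∧ k ≤ n ∧ pow A k u u = lam A v ^ k := by
  classical
  have hn : 0 < n := v.pos
  obtain ⟨⟨u, k⟩, hp, he⟩ := Finset.exists_mem_eq_sup
    ((Finset.univ.filter (SameComp (Edge A) v)) ×ˢ Finset.Icc 1 n)
    ⟨(v, 1), by
      simp only [Finset.mem_product, Finset.mem_filter, Finset.mem_univ, true_and,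
        Finset.mem_Icc]
      exact ⟨⟨.refl, .refl⟩, le_rfl, hn⟩⟩
    (fun p => pow A p.2 p.1 p.1 ^ (1 / (p.2 : ℝ)))
  rw [← lam_eq_sup] at he
  simp only [Finset.mem_product, Finset.mem_filter, Finset.mem_univ, true_and,
    Finset.mem_Icc] at hp
  refine ⟨u, k, hp.1, hp.2.1, hp.2.2, ?_⟩
  have hk : (0 : ℝ) < k := by exact_mod_cast hp.2.1
  rw [one_div] at he
  have := (NNReal.rpow_inv_eq_iff hk.ne').1 he.symm
  rw [this, NNReal.rpow_natCast]

/-! ### Walks in the critical digraph -/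

open Classical in
/-- The critical edges in the component of the node `v` with their weights. -/
noncomputable def critMatrix (A : Matrix (Fin n) (Fin n) ℝ≥0) (v : Fin n) :
    Matrix (Fin n) (Fin n) ℝ≥0 :=
  fun i j => if CritEdge (component A v) i j then A i j else 0

/-- The rest of a critical cycle through the edge leads back from its head to its tail, and the
whole cycle weighs the power of λ given by its length. -/
theorem CritEdge.return_walk {v i j : Fin n} (h : CritEdge (component A v) i j) :
    A i j ≠ 0 ∧ lam A v ≠ 0 ∧ SameComp (Edge A) v i ∧
      ∃ r, lam A v ^ (r + 1) ≤ pow A r j i * A i j := by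
  obtain ⟨k, c, hc, hm, t, ht, rfl, rfl⟩ := h
  obtain ⟨hc, hv⟩ := isCycle_component_iff.1 hc
  rw [geomMean_eq_iff hc.1, weight_component hc hv] at hm
  have hw := (isCycle_iff.1 hc).2.2
  refine ⟨hc.2.2 t ht, ?_, hv.trans (sameComp_of_cycle hc ht.le), k - 1, ?_⟩
  · rintro h0
    exact hw (by rw [hm, ← lam, h0, zero_pow hc.1.ne'])
  · obtain ⟨d, rfl⟩ := Nat.exists_eq_add_of_lt ht
    rw [← lam, add_right_comm, weight_add, weight, Finset.prod_range_succ, ← weight] at hm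
    rw [show t + d + 1 - 1 + 1 = t + 1 + d by omega, ← hm,
      show t + d + 1 - 1 = d + t by omega, mul_right_comm, mul_comm (weight A t c)]
    refine mul_le_mul_left (le_trans (mul_le_mul' (weight_le_pow _ _ _) (weight_le_pow _ _ _))
      (le_trans (le_of_eq ?_) (le_pow_add A d t _ (c 0) _))) _
    have := hc.2.1
    rw [show t + d + 1 = t + 1 + d by omega] at this
    simp [this]

theorem critMatrix_le (A : Matrix (Fin n) (Fin n) ℝ≥0) (v i j : Fin n) :
    critMatrix A v i j ≤ A i j := by
  unfold critMatrix
  split_ifs <;> simp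

theorem edge_critMatrix {v : Fin n} : Edge (critMatrix A v) = CritEdge (component A v) := by
  funext i j
  refine propext ⟨fun h => ?_, fun h => ?_⟩
  · by_contra hn
    exact h (if_neg hn)
  · rw [Edge, critMatrix, if_pos h]
    exact h.return_walk.1

theorem pow_mono {B : Matrix (Fin n) (Fin n) ℝ≥0} (h : ∀ i j, B i j ≤ A i j) (t : ℕ) (i j : Fin n) :
    pow B t i j ≤ pow A t i j := by
  induction t generalizing j with
  | zero => exact le_rfl
  | succ t ih => exact Finset.sup_mono_fun fun k _ => mul_le_mul' (ih k) (h k j)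

/-- The return walks of the single critical edges, concatenated in reverse order, close up any walk
in the critical digraph without falling below λ on average. -/
theorem exists_return {v : Fin n} (t : ℕ) {i j : Fin n} (h : pow (critMatrix A v) t i j ≠ 0) :
    ∃ r, lam A v ^ (r + t) ≤ pow A r j i * pow (critMatrix A v) t i j := by
  induction t generalizing j with
  | zero =>
    have hij : i = j := by
      by_contra hne
      exact h (by rw [pow]; exact Matrix.one_apply_ne hne)
    subst hij
    exact ⟨0, by simp [pow]⟩
  | succ t ih =>
    obtain ⟨u, hu⟩ := exists_mul_eq (pow (critMatrix A v) t) (critMatrix A v) i j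
    rw [pow, hu] at h
    rw [pow, hu]
    obtain ⟨r, hr⟩ := ih (left_ne_zero_of_mul h)
    have he : CritEdge (component A v) u j := by
      rw [← edge_critMatrix]; exact right_ne_zero_of_mul h
    obtain ⟨-, -, -, q, hq⟩ := he.return_walk
    have hA : critMatrix A v u j = A u j := if_pos he
    refine ⟨q + r, ?_⟩
    calc lam A v ^ (q + r + (t + 1)) = lam A v ^ (q + 1) * lam A v ^ (r + t) := by
          rw [← pow_add]; congr 1; omega
      _ ≤ (pow A q j u * A u j) * (pow A r u i * pow (critMatrix A v) t i u) := mul_le_mul' hq hr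
      _ = (pow A q j u * pow A r u i) * (pow (critMatrix A v) t i u * critMatrix A v u j) := by
          rw [hA]; ring
      _ ≤ _ := mul_le_mul_left (le_pow_add _ _ _ _ _ _) _

/-- Neither the critical closed walk nor its return walk, here also closed, can exceed its power of
λ, while their product reaches the power for the total length. Hence both bounds are attained. -/
theorem pow_eq_of_crit_walk {v : Fin n} (h0 : lam A v ≠ 0) {t : ℕ}
    (h : pow (critMatrix A v) t v v ≠ 0) : pow A t v v = lam A v ^ t := by
  obtain ⟨r, hr⟩ := exists_return t h
  refine le_antisymm (pow_self_le A t v) (le_trans ?_ (pow_mono (critMatrix_le A v) t v v))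
  rw [pow_add] at hr
  exact le_of_mul_le_mul_left (hr.trans (mul_le_mul_left (pow_self_le A r v) _))
    (pow_pos h0.bot_lt r)

theorem compCyclicity_dvd {v : Fin n} (hv : Crit A v) :
    compCyclicity (CritEdge (component A v)) v ∣ jointCyclicity A := by
  classical
  refine dvd_trans ?_ (Finset.dvd_lcm (Finset.mem_univ v))
  exact Finset.dvd_lcm (f := compCyclicity (CritEdge (component A v)))
    (by simpa using (show ∃ j, CritEdge (component A v) v j from hv))

/-- Critical nodes lie on critical closed walks of all large lengths divisible by the
cyclicity. -/
theorem exists_crit_walks {v : Fin n} (hv : Crit A v) :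
    ∃ N, ∀ m ≥ N, jointCyclicity A ∣ m → pow A m v v = lam A v ^ m := by
  classical
  set C := critMatrix A v with hC
  have h0 : lam A v ≠ 0 := by
    obtain ⟨j, hj⟩ := hv
    exact hj.return_walk.2.1
  -- The lengths of closed walks at v in the critical digraph form a numerical monoid, which
  -- contains all large multiples of its g.c.d. A simple cycle of length k in the component of v
  -- yields members s + t and s + k + t, so this g.c.d. divides k, hence the cyclicity.
  let S : AddSubmonoid ℕ :=
    { carrier := {m | pow C m v v ≠ 0}
      zero_mem' := by simp [pow]
      add_mem' := fun ha hb => pow_add_ne_zero ha hb }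
  have hS : ∀ m, m ∈ S ↔ pow C m v v ≠ 0 := fun m => Iff.rfl
  obtain ⟨N, hN⟩ := Nat.exists_mem_closure_of_ge (S : Set ℕ)
  rw [AddSubmonoid.closure_eq] at hN
  refine ⟨N, fun m hm hd => pow_eq_of_crit_walk h0 ((hS m).1 (hN m hm (dvd_trans ?_ hd)))⟩
  refine dvd_trans (Finset.dvd_gcd fun k hk => ?_) (compCyclicity_dvd hv)
  simp only [Finset.mem_filter, ← edge_critMatrix, ← hC] at hk
  obtain ⟨-, c, hc, -, hs⟩ := hk
  obtain ⟨⟨s, hs⟩, t, ht⟩ := sameComp_iff.1 hs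
  have hk : pow C k (c 0) (c 0) ≠ 0 := by
    have := ((isCycle_iff.1 hc).2.2.bot_lt.trans_le (weight_le_pow _ _ _)).ne'
    rwa [hc.2.1] at this
  have h1 : Nat.setGcd S ∣ s + t := Nat.setGcd_dvd_of_mem ((hS _).2 (pow_add_ne_zero hs ht))
  have h2 : Nat.setGcd S ∣ s + k + t :=
    Nat.setGcd_dvd_of_mem ((hS _).2 (pow_add_ne_zero (pow_add_ne_zero hs hk) ht))
  rw [add_right_comm] at h2
  exact (Nat.dvd_add_right h1).1 h2

theorem IsCycle.exists_simple {E : Fin n → Fin n → Prop} {k : ℕ} {c : ℕ → Fin n}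
    (h : IsCycle E k c) :
    ∃ l d, IsCycle E l d ∧ Set.InjOn d (Set.Iio l) ∧ ∃ s, d 0 = c s ∧ s ≤ k := by
  induction k using Nat.strong_induction_on generalizing c with
  | _ k ih =>
  by_cases hinj : Set.InjOn c (Set.Iio k)
  · exact ⟨k, c, h, hinj, 0, rfl, zero_le⟩
  · simp only [Set.InjOn, Set.mem_Iio] at hinj
    push Not at hinj
    obtain ⟨x, hx, y, hy, hxy, hne⟩ := hinj
    wlog hlt : x < y generalizing x y
    · exact this y hy x hx hxy.symm hne.symm (by omega)
    obtain ⟨l, d, hd, hi, s, hs, hsl⟩ := ih (y - x) (by omega) (c := fun m => c (x + m))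
      ⟨by omega, by simp [Nat.add_sub_cancel' hlt.le, hxy], fun t ht => h.2.2 (x + t) (by omega)⟩
    exact ⟨l, d, hd, hi, x + s, hs, by omega⟩

/-- The g.c.d. of an empty set of lengths would be 0 and would annihilate the l.c.m. This is
excluded because a component with a critical edge contains a simple cycle, which has at most n
edges. -/
theorem jointCyclicity_pos (A : Matrix (Fin n) (Fin n) ℝ≥0) : 0 < jointCyclicity A := by
  classical
  refine Nat.pos_of_ne_zero fun h0 => ?_
  obtain ⟨m, -, hm⟩ := Finset.lcm_eq_zero_iff.1 h0
  obtain ⟨i, hi, hc⟩ := Finset.lcm_eq_zero_iff.1 hm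
  obtain ⟨j, k, c, hcyc, hmean, t, ht, rfl, rfl⟩ := (Finset.mem_filter.1 hi).2
  have hE : IsCycle (CritEdge (component A m)) k c :=
    ⟨hcyc.1, hcyc.2.1, fun s hs => ⟨k, c, hcyc, hmean, s, hs, rfl, rfl⟩⟩
  obtain ⟨l, d, hd, hi, s, hs, hsk⟩ := hE.exists_simple
  have hln : l ≤ n := by
    have := Finset.card_le_card_of_injOn (s := Finset.range l) (t := Finset.univ) d (by simp)
      (by simpa using hi)
    simpa using this
  have hE' := hE
  rw [← edge_critMatrix] at hE'
  have hsame := (sameComp_of_cycle hE' ht.le).symm.trans (sameComp_of_cycle hE' hsk)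
  rw [edge_critMatrix, ← hs] at hsame
  rw [compCyclicity, Finset.gcd_eq_zero_iff] at hc
  have := hc l (by
    rw [Finset.mem_filter, Finset.mem_Icc]
    exact ⟨⟨hd.1, hln⟩, d, hd, hi, hsame⟩)
  exact hd.1.ne' this

end Components

/-! ### Growth rates of the entries of matrix powers -/

section Rates

variable {n : ℕ} {A : Matrix (Fin n) (Fin n) ℝ≥0}

/-- There is a walk of length `t` from `i` to `j` that visits `v`. -/
def Thru (A : Matrix (Fin n) (Fin n) ℝ≥0) (i v j : Fin n) (t : ℕ) : Prop :=
  ∃ a b, a + b = t ∧ pow A a i v ≠ 0 ∧ pow A b v j ≠ 0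

theorem Thru.pow_ne_zero {i v j : Fin n} {t : ℕ} (h : Thru A i v j t) : pow A t i j ≠ 0 := by
  obtain ⟨a, b, rfl, h1, h2⟩ := h
  exact pow_add_ne_zero h1 h2

theorem Thru.append {i v j k : Fin n} {s t : ℕ} (h : Thru A i v j s) (h' : pow A t j k ≠ 0) :
    Thru A i v k (s + t) := by
  obtain ⟨a, b, rfl, h1, h2⟩ := h
  exact ⟨a, b + t, by ring, h1, pow_add_ne_zero h2 h'⟩

theorem Thru.prepend {i v j k : Fin n} {s t : ℕ} (h' : pow A s k i ≠ 0) (h : Thru A i v j t) :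
    Thru A k v j (s + t) := by
  obtain ⟨a, b, rfl, h1, h2⟩ := h
  exact ⟨s + a, b, by ring, pow_add_ne_zero h' h1, h2⟩

theorem Thru.insert {i v j : Fin n} {s t : ℕ} (h : Thru A i v j s) (h' : pow A t v v ≠ 0) :
    Thru A i v j (s + t) := by
  obtain ⟨a, b, rfl, h1, h2⟩ := h
  exact ⟨a + t, b, by ring, pow_add_ne_zero h1 h', h2⟩

/-- Make the round trip v → u → v of length p + q exactly g times: u gets visited and the length
modulo g is unchanged. -/
theorem Thru.sameComp {i v u j : Fin n} {t g : ℕ} (h : Thru A i v j t)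
    (hu : SameComp (Edge A) v u) (hg : 0 < g) : ∃ t', t' ≡ t [MOD g] ∧ Thru A i u j t' := by
  obtain ⟨a, b, rfl, h1, h2⟩ := h
  obtain ⟨⟨p, hp⟩, q, hq⟩ := sameComp_iff.1 hu
  refine ⟨a + b + g * (p + q), by simp [Nat.ModEq], a + p, q + (g - 1) * (p + q) + b, ?_,
    pow_add_ne_zero h1 hp,
    pow_add_ne_zero (pow_add_ne_zero hq (pow_mul_ne_zero (pow_add_ne_zero hp hq) _)) h2⟩
  obtain ⟨g, rfl⟩ := Nat.exists_eq_add_of_lt hg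
  simp only [zero_add, Nat.add_sub_cancel]
  ring

open Classical in
/-- The growth rate of the entry `i, j` of `A ^ t` for `t` congruent to `r` modulo the joint
cyclicity. -/
noncomputable def rate (A : Matrix (Fin n) (Fin n) ℝ≥0) (i j : Fin n) (r : ℕ) : ℝ≥0 :=
  (Finset.univ.filter fun v => ∃ t, t ≡ r [MOD jointCyclicity A] ∧ Thru A i v j t).sup (lam A)

theorem Thru.lam_le_rate {i v j : Fin n} {t r : ℕ} (h : Thru A i v j t)
    (hr : t ≡ r [MOD jointCyclicity A]) : lam A v ≤ rate A i j r := by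
  classical
  exact Finset.le_sup (f := lam A) (by simpa using ⟨t, hr, h⟩)

theorem exists_lam_eq_rate {i j : Fin n} {r : ℕ} (h : rate A i j r ≠ 0) :
    ∃ v t, t ≡ r [MOD jointCyclicity A] ∧ Thru A i v j t ∧ lam A v = rate A i j r := by
  classical
  unfold rate at h ⊢
  obtain ⟨v, hv, he⟩ := Finset.exists_mem_eq_sup
    (Finset.univ.filter fun v => ∃ t, t ≡ r [MOD jointCyclicity A] ∧ Thru A i v j t)
    (Finset.nonempty_iff_ne_empty.2 fun h0 => h (by rw [h0]; rfl)) (lam A)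
  obtain ⟨t, ht, htv⟩ := (Finset.mem_filter.1 hv).2
  exact ⟨v, t, ht, htv, he.symm⟩

theorem rate_congr {i j : Fin n} {r s : ℕ} (h : r ≡ s [MOD jointCyclicity A]) :
    rate A i j r = rate A i j s := by
  unfold rate
  congr 1
  ext v
  simp only [Finset.mem_filter, Finset.mem_univ, true_and]
  exact ⟨fun ⟨t, ht, h'⟩ => ⟨t, ht.trans h, h'⟩, fun ⟨t, ht, h'⟩ => ⟨t, ht.trans h.symm, h'⟩⟩

theorem exists_crit {v : Fin n} (h : lam A v ≠ 0) :
    ∃ u, SameComp (Edge A) v u ∧ Crit A u ∧ lam A u = lam A v ∧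
      ∃ k, 0 < k ∧ k ≤ n ∧ pow A k u u = lam A v ^ k := by
  obtain ⟨u, k, hs, hk, hkn, he⟩ := exists_attained A v
  have hl := lam_eq_of_sameComp hs
  exact ⟨u, hs, crit_of_pow_eq hk (hl ▸ h) (hl ▸ he), hl.symm, k, hk, hkn, he⟩

/-- Closed subwalks can be removed from a walk without decreasing its normalized weight. -/
theorem exists_short {i j : Fin n} {l : ℝ≥0} {g a : ℕ} (hg : 0 < g)
    (hl : ∀ w t, t ≡ a [MOD g] → Thru A i w j t → lam A w ≤ l) (h : pow A a i j ≠ 0) :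
    ∃ b, b < n * g ∧ b ≡ a [MOD g] ∧ pow A b i j ≠ 0 ∧
      pow A a i j * l ^ b ≤ pow A b i j * l ^ a := by
  induction a using Nat.strong_induction_on with
  | _ a ih =>
  by_cases ha : a < n * g
  · exact ⟨a, ha, rfl, h, le_rfl⟩
  obtain ⟨u, x, b, y, rfl, hb, hgb, -, he⟩ := exists_closed_split hg (not_lt.1 ha) h
  have hm : x + y ≡ x + b + y [MOD g] := by
    rw [add_right_comm]
    exact ((Nat.modEq_zero_iff_dvd.2 hgb).add_left (x + y)).symm
  have h' := h
  rw [he] at h'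
  have hx := left_ne_zero_of_mul (left_ne_zero_of_mul h')
  have hbb := right_ne_zero_of_mul (left_ne_zero_of_mul h')
  have hy := right_ne_zero_of_mul h'
  obtain ⟨c, hc, hcm, hc0, hle⟩ := ih (x + y) (by omega)
    (fun w t ht => hl w t (ht.trans hm)) (pow_add_ne_zero hx hy)
  refine ⟨c, hc, hcm.trans hm, hc0, ?_⟩
  have hbl : pow A b u u ≤ l ^ b :=
    (pow_self_le A b u).trans (pow_le_pow_left' (hl u (x + y) hm ⟨x, y, rfl, hx, hy⟩) b)
  calc pow A (x + b + y) i j * l ^ c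
      = (pow A x i u * pow A y u j) * l ^ c * pow A b u u := by rw [he]; ring
    _ ≤ pow A (x + y) i j * l ^ c * l ^ b := by
        gcongr
        exact le_pow_add _ _ _ _ _ _
    _ ≤ pow A c i j * l ^ (x + y) * l ^ b := by gcongr
    _ = pow A c i j * l ^ (x + b + y) := by rw [mul_assoc, ← pow_add]; congr 2; omega

/-- If all closed walks have geometric means below `l`, then the powers are of smaller order than
the powers of `l`. -/
theorem eventually_pow_le {l : ℝ≥0} (hl : 0 < l)
    (h : ∀ b u, 0 < b → pow A b u u < l ^ b) {ε : ℝ≥0} (hε : 0 < ε) :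
    ∃ T, ∀ t ≥ T, ∀ i j, pow A t i j ≤ ε * l ^ t := by
  set S := ((Finset.univ : Finset (Fin n)) ×ˢ Finset.Icc 1 n).sup
      fun p => pow A p.2 p.1 p.1 ^ ((p.2 : ℝ)⁻¹) with hS
  -- Any base strictly between the cycle means and l would do. The term l / 2 keeps m positive, so
  -- that dividing by powers of m is harmless even if there are no cycles.
  set m := max (l / 2) S with hm
  have hm0 : 0 < m := lt_max_of_lt_left (by positivity)
  have hml : m < l := by
    refine max_lt (NNReal.half_lt_self hl.ne') ((Finset.sup_lt_iff hl).2 ?_)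
    rintro ⟨u, k⟩ hk
    simp only [Finset.mem_product, Finset.mem_univ, true_and, Finset.mem_Icc] at hk
    have hk0 : (0 : ℝ) < k := by exact_mod_cast hk.1
    rw [NNReal.rpow_inv_lt_iff hk0, NNReal.rpow_natCast]
    exact h k u hk.1
  have hcyc : ∀ b u, 0 < b → b ≤ n → pow A b u u ≤ m ^ b := by
    intro b u hb hbn
    have hb0 : (0 : ℝ) < b := by exact_mod_cast hb
    rw [← NNReal.rpow_natCast, ← NNReal.rpow_inv_le_iff hb0]
    refine le_trans ?_ (le_max_right _ _)
    exact Finset.le_sup (f := fun p : Fin n × ℕ => pow A p.2 p.1 p.1 ^ ((p.2 : ℝ)⁻¹))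
      (b := (u, b)) (by simp; omega)
  set C := (Finset.range n ×ˢ (Finset.univ : Finset (Fin n × Fin n))).sup
      fun p => pow A p.1 p.2.1 p.2.2 / m ^ p.1 with hC
  have key : ∀ t i j, pow A t i j ≤ C * m ^ t := by
    intro t
    induction t using Nat.strong_induction_on with
    | _ t ih =>
    intro i j
    by_cases ht : t < n
    · rw [← div_le_iff₀ (pow_pos hm0 t)]
      exact Finset.le_sup (f := fun p : ℕ × Fin n × Fin n => pow A p.1 p.2.1 p.2.2 / m ^ p.1)
        (b := (t, i, j)) (by simpa using ht)
    by_cases h0 : pow A t i j = 0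
    · rw [h0]; exact zero_le
    obtain ⟨u, x, b, y, rfl, hb, -, hbn, he⟩ :=
      exists_closed_split (g := 1) one_pos (by omega) h0
    calc pow A (x + b + y) i j = (pow A x i u * pow A y u j) * pow A b u u := by rw [he]; ring
      _ ≤ (C * m ^ (x + y)) * m ^ b :=
          mul_le_mul' ((le_pow_add _ _ _ _ _ _).trans (ih (x + y) (by omega) i j))
            (hcyc b u hb (by omega))
      _ = C * m ^ (x + b + y) := by rw [mul_assoc, ← pow_add]; congr 2; omega
  obtain ⟨T, hT⟩ := NNReal.exists_pow_lt_of_lt_one (a := ε / (C + 1)) (by positivity)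
    (b := m / l) ((div_lt_one hl).2 hml)
  refine ⟨T, fun t ht i j => (key t i j).trans ?_⟩
  have h1 : (m / l) ^ t ≤ ε / (C + 1) :=
    (pow_le_pow_of_le_one zero_le ((div_le_one hl).2 hml.le) ht).trans hT.le
  rw [div_pow, div_le_iff₀ (pow_pos hl t)] at h1
  calc C * m ^ t ≤ (C + 1) * (ε / (C + 1) * l ^ t) := by
        gcongr
        exact le_self_add
    _ = ε * l ^ t := by
        rw [← mul_assoc, mul_div_cancel₀ _ (by positivity : C + 1 ≠ 0)]

end Rates

/-! ### Ultimately geometric entries along residue classes -/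

section Asymptotics

variable {n : ℕ} {A : Matrix (Fin n) (Fin n) ℝ≥0}

open Classical in
/-- The matrix `A` without the edges at the nodes outside `S`. -/
noncomputable def restrict (A : Matrix (Fin n) (Fin n) ℝ≥0) (S : Set (Fin n)) :
    Matrix (Fin n) (Fin n) ℝ≥0 :=
  fun i j => if i ∈ S ∧ j ∈ S then A i j else 0

theorem restrict_le (A : Matrix (Fin n) (Fin n) ℝ≥0) (S : Set (Fin n)) (i j : Fin n) :
    restrict A S i j ≤ A i j := by
  unfold restrict
  split_ifs <;> simp

theorem pow_restrict_eq_zero {S : Set (Fin n)} {u : Fin n} (hu : u ∉ S) {b : ℕ} (hb : 0 < b)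
    (i : Fin n) : pow (restrict A S) b i u = 0 := by
  obtain ⟨b, rfl⟩ := Nat.exists_eq_succ_of_ne_zero hb.ne'
  obtain ⟨v, hv⟩ := exists_mul_eq (pow (restrict A S) b) (restrict A S) i u
  rw [pow, hv, restrict, if_neg (fun h => hu h.2), mul_zero]

/-- Along a residue class modulo the joint cyclicity, the entries of the powers are ultimately
geometric sequences. -/
theorem exists_eventually_eq (A : Matrix (Fin n) (Fin n) ℝ≥0) (i j : Fin n) (r : ℕ) :
    ∃ W : ℝ≥0, (W = 0 ↔ rate A i j r = 0) ∧
      ∃ T, ∀ t ≥ T, t ≡ r [MOD jointCyclicity A] → pow A t i j = W * rate A i j r ^ t := by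
  classical
  set g := jointCyclicity A with hg
  have hg0 : 0 < g := jointCyclicity_pos A
  by_cases h0 : rate A i j r = 0
  -- With rate 0, no walk in this residue class meets a cycle; a walk with at least n edges always
  -- does, so the entry vanishes from n on.
  · refine ⟨0, by simp [h0], n, fun t ht hr => ?_⟩
    rw [zero_mul]
    by_contra h
    obtain ⟨u, a, b, d, rfl, hb, -, -, he⟩ := exists_closed_split (g := 1) one_pos (by omega) h
    rw [he] at h
    have hx := left_ne_zero_of_mul (left_ne_zero_of_mul h)
    have hbb := right_ne_zero_of_mul (left_ne_zero_of_mul h)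
    have hy := right_ne_zero_of_mul h
    have hth : Thru A i u j (a + b + d) := ⟨a, b + d, by ring, hx, pow_add_ne_zero hbb hy⟩
    have := hth.lam_le_rate hr
    rw [h0] at this
    exact lam_ne_zero hb hbb (le_zero_iff.1 this)
  set l := rate A i j r with hl
  have hl0 : 0 < l := pos_iff_ne_zero.2 h0
  let K : Fin n → Prop := fun u => Crit A u ∧ lam A u = l
  -- Only finitely many candidates compete for the coefficient: a dominant critical node together
  -- with lengths below n·g for the walks before and after it. The function f is the weight
  -- normalized by the power of l.
  let Z : Finset (Fin n × ℕ × ℕ) :=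
    (Finset.univ ×ˢ Finset.range (n * g) ×ˢ Finset.range (n * g)).filter
      fun p => K p.1 ∧ p.2.1 + p.2.2 ≡ r [MOD g]
  let f : Fin n × ℕ × ℕ → ℝ≥0 :=
    fun p => pow A p.2.1 i p.1 * pow A p.2.2 p.1 j / l ^ (p.2.1 + p.2.2)
  have short : ∀ u a b, K u → a + b ≡ r [MOD g] → pow A a i u ≠ 0 → pow A b u j ≠ 0 →
      ∃ p ∈ Z, f p ≠ 0 ∧ pow A a i u * pow A b u j ≤ f p * l ^ (a + b) := by
    intro u a b hu hr ha hb
    obtain ⟨a', ha', hma, ha0, hla⟩ := exists_short (l := l) hg0 (fun w t ht hw =>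
      (hw.append hb).lam_le_rate ((ht.add_right b).trans hr)) ha
    obtain ⟨b', hb', hmb, hb0, hlb⟩ := exists_short (l := l) hg0 (fun w t ht hw =>
      (hw.prepend ha).lam_le_rate ((ht.add_left a).trans hr)) hb
    refine ⟨(u, a', b'), ?_, ?_, ?_⟩
    · simp only [Z, Finset.mem_filter, Finset.mem_product, Finset.mem_univ, true_and,
        Finset.mem_range]
      exact ⟨⟨ha', hb'⟩, hu, (hma.add hmb).trans hr⟩
    · exact div_ne_zero (mul_ne_zero ha0 hb0) (pow_pos hl0 _).ne'
    · simp only [f]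
      rw [div_mul_eq_mul_div, le_div_iff₀ (pow_pos hl0 _)]
      calc pow A a i u * pow A b u j * l ^ (a' + b')
          = (pow A a i u * l ^ a') * (pow A b u j * l ^ b') := by ring
        _ ≤ (pow A a' i u * l ^ a) * (pow A b' u j * l ^ b) := mul_le_mul' hla hlb
        _ = _ := by ring
  obtain ⟨v, t, ht, hv, hvl⟩ := exists_lam_eq_rate h0
  obtain ⟨u, hs, hc, hul, -⟩ := exists_crit (v := v) (by rw [hvl]; exact h0)
  obtain ⟨t', ht', a, b, rfl, ha, hb⟩ := hv.sameComp hs hg0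
  obtain ⟨p, hpZ, hp0, -⟩ := short u a b ⟨hc, hul.trans hvl⟩ (ht'.trans ht) ha hb
  obtain ⟨q, hqZ, hq⟩ := Finset.exists_mem_eq_sup Z ⟨p, hpZ⟩ f
  set W := Z.sup f with hW
  have hW0 : 0 < W := (pos_iff_ne_zero.2 hp0).trans_le (Finset.le_sup hpZ)
  refine ⟨W, by simp [hW0.ne', h0], ?_⟩
  have upper : ∀ u a b, K u → a + b ≡ r [MOD g] →
      pow A a i u * pow A b u j ≤ W * l ^ (a + b) := by
    intro u a b hu hr
    by_cases h : pow A a i u * pow A b u j = 0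
    · rw [h]; exact zero_le
    obtain ⟨p, hp, -, hle⟩ := short u a b hu hr (left_ne_zero_of_mul h) (right_ne_zero_of_mul h)
    exact hle.trans (mul_le_mul_left (Finset.le_sup hp) _)
  -- Inside S all closed walks have means strictly below l: one with mean l would make its node
  -- critical with λ = l, which S excludes. Walks that miss the dominant critical nodes are thus
  -- negligible.
  let S : Set (Fin n) := {u | ¬ K u ∧ lam A u ≤ l}
  obtain ⟨T₁, hT₁⟩ := eventually_pow_le (A := restrict A S) hl0 (fun b u hb => by
    by_cases hu : u ∈ S
    · refine lt_of_le_of_ne ((pow_mono (restrict_le A S) b u u).trans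
        ((pow_self_le A b u).trans (pow_le_pow_left' hu.2 b))) fun he => ?_
      have h1 : l ^ b ≤ pow A b u u := he ▸ pow_mono (restrict_le A S) b u u
      have h2 : lam A u = l := le_antisymm hu.2
        ((pow_le_pow_iff_left₀ zero_le zero_le hb.ne').1 (h1.trans (pow_self_le A b u)))
      exact hu.1 ⟨crit_of_pow_eq hb (h2 ▸ h0) (le_antisymm (pow_self_le A b u) (h2 ▸ h1)), h2⟩
    · rw [pow_restrict_eq_zero hu hb]
      exact pow_pos hl0 b) hW0
  obtain ⟨u, a, b⟩ := q
  obtain ⟨-, ⟨hcu, hlu⟩, hab⟩ := Finset.mem_filter.1 hqZ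
  obtain ⟨N, hN⟩ := exists_crit_walks hcu
  -- Past `T₁` the walks inside S stay below W·l^t. For the lower bound, the best candidate (u, a,
  -- b) is stretched by a critical closed walk at u of length t - a - b, which must be at least N
  -- and is divisible by γ.
  refine ⟨T₁ + a + b + N, fun t ht hr => le_antisymm ?_ ?_⟩
  · by_cases hp0 : pow A t i j = 0
    · rw [hp0]; exact zero_le
    obtain ⟨c, hci, hcj, hc⟩ := exists_weight_eq hp0
    have hc0 : ∀ s ≤ t, pow A t i j = pow A s i (c s) * pow A (t - s) (c s) j := by
      intro s hs
      obtain ⟨d, rfl⟩ := Nat.exists_eq_add_of_le hs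
      have := pow_eq_of_optimal (s := s) (t := d) (c := c) (by rw [hci, hcj, hc])
      rw [hci, hcj] at this
      rw [this, Nat.add_sub_cancel_left]
    by_cases hK : ∃ s ≤ t, K (c s)
    · obtain ⟨s, hs, hK⟩ := hK
      rw [hc0 s hs]
      have := upper (c s) s (t - s) hK (by rwa [Nat.add_sub_cancel' hs])
      rwa [Nat.add_sub_cancel' hs] at this
    · push Not at hK
      have hS : ∀ s ≤ t, c s ∈ S := by
        intro s hs
        refine ⟨hK s hs, Thru.lam_le_rate (t := t) ⟨s, t - s, Nat.add_sub_cancel' hs, ?_, ?_⟩ hr⟩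
        · exact left_ne_zero_of_mul (hc0 s hs ▸ hp0)
        · exact right_ne_zero_of_mul (hc0 s hs ▸ hp0)
      have hw : weight (restrict A S) t c = weight A t c :=
        Finset.prod_congr rfl fun s hs => by
          have := Finset.mem_range.1 hs
          exact if_pos ⟨hS s this.le, hS (s + 1) this⟩
      have := weight_le_pow (restrict A S) t c
      rw [hw, hc, hci, hcj] at this
      exact this.trans (hT₁ t (by omega) i j)
  · obtain ⟨d, rfl⟩ := Nat.exists_eq_add_of_le (show a + b ≤ t by omega)
    have hd : jointCyclicity A ∣ d := by
      have : a + b + d ≡ a + b + 0 [MOD g] := hr.trans hab.symm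
      exact Nat.modEq_zero_iff_dvd.1 (Nat.ModEq.add_left_cancel' _ this)
    have hcl := hN d (by omega) hd
    rw [hlu] at hcl
    simp only [f] at hq
    rw [hq, div_mul_eq_mul_div, pow_add l (a + b) d, mul_div_assoc,
      mul_div_cancel_left₀ _ (pow_pos hl0 _).ne']
    calc pow A a i u * pow A b u j * l ^ d
        = pow A a i u * (pow A d u u * pow A b u j) := by rw [hcl]; ring
      _ ≤ pow A a i u * pow A (d + b) u j := by gcongr; exact le_pow_add _ _ _ _ _ _
      _ ≤ pow A (a + (d + b)) i j := le_pow_add _ _ _ _ _ _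
      _ = _ := by congr 1; ring

end Asymptotics

/-! ### Orbit periodicity in terms of growth rates -/

section Orbits

variable {n : ℕ} {A : Matrix (Fin n) (Fin n) ℝ≥0}

open Filter

theorem eventually_mul_pow_le {x z : ℝ≥0} (h : x < z) (a : ℝ≥0) {b : ℝ≥0} (hb : 0 < b) :
    ∀ᶠ t : ℕ in atTop, a * x ^ t ≤ b * z ^ t := by
  have hz : 0 < z := bot_lt_of_lt h
  obtain ⟨T, hT⟩ := NNReal.exists_pow_lt_of_lt_one (a := b / (a + 1)) (by positivity)
    (b := x / z) ((div_lt_one hz).2 h)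
  filter_upwards [eventually_ge_atTop T] with t ht
  have h1 : (x / z) ^ t ≤ b / (a + 1) :=
    (pow_le_pow_of_le_one zero_le ((div_le_one hz).2 h.le) ht).trans hT.le
  rw [div_pow, div_le_iff₀ (pow_pos hz t)] at h1
  calc a * x ^ t ≤ (a + 1) * (b / (a + 1) * z ^ t) := by
        gcongr
        exact le_self_add
    _ = b * z ^ t := by
        rw [← mul_assoc, mul_div_cancel₀ _ (by positivity : a + 1 ≠ 0)]

theorem le_of_mul_pow_le {x y a b : ℝ≥0} (ha : 0 < a) (h : ∀ m : ℕ, a * x ^ m ≤ b * y ^ m) :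
    x ≤ y := by
  by_contra! hlt
  obtain ⟨m, hm⟩ := (eventually_mul_pow_le hlt b (b := a / 2) (by positivity)).exists
  have hx : 0 < x := bot_lt_of_lt hlt
  have h1 := (h m).trans hm
  have h2 : a / 2 * x ^ m < a * x ^ m := mul_lt_mul_of_pos_right (NNReal.half_lt_self ha.ne')
    (pow_pos hx m)
  exact absurd h1 (not_le.2 h2)

theorem eventually_of_residues {g : ℕ} (hg : 0 < g) {p : ℕ → Prop}
    (h : ∀ r, ∀ᶠ t in atTop, t ≡ r [MOD g] → p t) : ∀ᶠ t in atTop, p t := by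
  have := (Filter.eventually_all_finset (Finset.range g)).2 fun r _ => h r
  filter_upwards [this] with t ht
  exact ht (t % g) (Finset.mem_range.2 (Nat.mod_lt _ hg)) (Nat.mod_modEq t g).symm

theorem exists_uniform (A : Matrix (Fin n) (Fin n) ℝ≥0) :
    ∃ W : Fin n → Fin n → ℕ → ℝ≥0, (∀ i j t, W i j t = 0 ↔ rate A i j t = 0) ∧
      (∀ i j s t, s ≡ t [MOD jointCyclicity A] → W i j s = W i j t) ∧
      ∀ᶠ t in atTop, ∀ i j, pow A t i j = W i j t * rate A i j t ^ t := by
  choose W hW hT using exists_eventually_eq A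
  -- The coefficients were chosen separately for every number r; reducing the index first makes them
  -- depend on the residue class alone.
  refine ⟨fun i j t => W i j (t % jointCyclicity A), fun i j t => ?_, fun i j s t h => ?_, ?_⟩
  · rw [hW, rate_congr (Nat.mod_modEq t _)]
  · exact congrArg (W i j) h
  · refine eventually_of_residues (jointCyclicity_pos A) fun r => ?_
    have : ∀ᶠ t in atTop, ∀ i j, t ≡ r % jointCyclicity A [MOD jointCyclicity A] →
        pow A t i j = W i j (r % jointCyclicity A) * rate A i j (r % jointCyclicity A) ^ t :=
      eventually_all.2 fun i => eventually_all.2 fun j => eventually_atTop.2 (hT i j _)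
    filter_upwards [this] with t ht hr i j
    have hr' := hr.trans (Nat.mod_modEq r _).symm
    rw [ht i j hr', show t % jointCyclicity A = r % jointCyclicity A from hr,
      rate_congr hr']

/-- The growth rates of any two columns, taken together, agree in all rows and residue classes in
which they do not vanish. -/
def RatesAgree (A : Matrix (Fin n) (Fin n) ℝ≥0) : Prop :=
  ∀ j k i i' r r', max (rate A i j r) (rate A i k r) ≠ 0 →
    max (rate A i' j r') (rate A i' k r') ≠ 0 →
    max (rate A i j r) (rate A i k r) = max (rate A i' j r') (rate A i' k r')

/-- Start the orbit at the indicator vector of {j, k}. Row i is then the maximum of the entries in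
these two columns, which along a residue class lies between constant multiples of M^t, where M is
the joint rate. Periodicity makes it geometric with ratio ρ^γ, so M = ρ whatever i and r are. -/
theorem OrbitPeriodic.ratesAgree (h : OrbitPeriodic A) : RatesAgree A := by
  classical
  obtain ⟨W, hW0, hWp, hW⟩ := exists_uniform A
  intro j k
  obtain ⟨ρ, T, hT⟩ := h fun x => if x = j ∨ x = k then 1 else 0
  obtain ⟨T', hT'⟩ := eventually_atTop.1 hW
  set g := jointCyclicity A with hg
  have hg0 : 0 < g := jointCyclicity_pos A
  have hmv : ∀ (B : Matrix (Fin n) (Fin n) ℝ≥0) i,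
      mulVec B (fun x => if x = j ∨ x = k then 1 else 0) i = max (B i j) (B i k) := by
    intro B i
    refine le_antisymm (Finset.sup_le fun x _ => ?_) (max_le ?_ ?_)
    · by_cases hj : x = j
      · subst hj; simp
      · by_cases hk : x = k
        · subst hk; simp
        · simp [hj, hk]
    · refine le_trans ?_ (Finset.le_sup
        (f := fun x => B i x * if x = j ∨ x = k then 1 else 0) (Finset.mem_univ j))
      simp
    · refine le_trans ?_ (Finset.le_sup
        (f := fun x => B i x * if x = j ∨ x = k then 1 else 0) (Finset.mem_univ k))
      simp
  have key : ∀ i r, max (rate A i j r) (rate A i k r) ≠ 0 →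
      max (rate A i j r) (rate A i k r) = ρ := by
    intro i r hM
    set M := max (rate A i j r) (rate A i k r) with hMdef
    set t₀ := r + g * (T + T') with ht₀
    have ht₀' : T + T' ≤ t₀ := by
      rw [ht₀]; nlinarith [Nat.zero_le r, Nat.zero_le (T + T')]
    have hmod : ∀ m, t₀ + m * g ≡ r [MOD g] := fun m => by simp [ht₀, Nat.ModEq]
    have hiter : ∀ m, max (pow A (t₀ + m * g) i j) (pow A (t₀ + m * g) i k) =
        max (pow A t₀ i j) (pow A t₀ i k) * (ρ ^ g) ^ m := by
      intro m
      induction m with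
      | zero => simp
      | succ m ih =>
        have := congrFun (hT (t₀ + m * g) (by omega)) i
        rw [Pi.smul_apply, hmv, hmv, ih, smul_eq_mul] at this
        rw [show t₀ + (m + 1) * g = t₀ + m * g + g by ring, this]
        ring
    have hent : ∀ m x, pow A (t₀ + m * g) i x = W i x r * rate A i x r ^ (t₀ + m * g) := by
      intro m x
      rw [hT' _ (by omega), hWp i x _ r (hmod m), rate_congr (hmod m)]
    have hpow : ∀ m, M ^ (t₀ + m * g) = M ^ t₀ * (M ^ g) ^ m := fun m => by
      rw [pow_add, mul_comm m, pow_mul]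
    have lower : ∃ c > 0, ∀ m, c * M ^ (t₀ + m * g) ≤
        max (pow A (t₀ + m * g) i j) (pow A (t₀ + m * g) i k) := by
      rcases max_choice (rate A i j r) (rate A i k r) with hc | hc
      · refine ⟨W i j r, pos_iff_ne_zero.2 fun h0 => hM ?_, fun m => le_max_of_le_left ?_⟩
        · rw [hMdef, hc, ← hW0]; exact h0
        · rw [hent, hMdef, hc]
      · refine ⟨W i k r, pos_iff_ne_zero.2 fun h0 => hM ?_, fun m => le_max_of_le_right ?_⟩
        · rw [hMdef, hc, ← hW0]; exact h0
        · rw [hent, hMdef, hc]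
    have upper : ∀ m, max (pow A (t₀ + m * g) i j) (pow A (t₀ + m * g) i k) ≤
        (W i j r + W i k r) * M ^ (t₀ + m * g) := by
      intro m
      rw [hent, hent]
      refine max_le (mul_le_mul' le_self_add (pow_le_pow_left' (le_max_left _ _) _))
        (mul_le_mul' le_add_self (pow_le_pow_left' (le_max_right _ _) _))
    obtain ⟨c, hc0, hc⟩ := lower
    have hM0 : 0 < M := pos_iff_ne_zero.2 hM
    have h1 : M ^ g ≤ ρ ^ g := le_of_mul_pow_le (a := c * M ^ t₀)
      (b := max (pow A t₀ i j) (pow A t₀ i k)) (mul_pos hc0 (pow_pos hM0 _)) fun m => by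
        rw [← hiter, mul_assoc, ← hpow]
        exact hc m
    have h2 : ρ ^ g ≤ M ^ g := le_of_mul_pow_le (a := max (pow A t₀ i j) (pow A t₀ i k))
      (b := (W i j r + W i k r) * M ^ t₀)
      (lt_of_lt_of_le (mul_pos hc0 (pow_pos hM0 t₀)) (by simpa using hc 0)) fun m => by
        rw [← hiter, mul_assoc, ← hpow]
        exact upper m
    exact (pow_left_inj₀ zero_le zero_le hg0.ne').1 (le_antisymm h1 h2)
  intro i i' r r' h1 h2
  rw [key i r h1, key i' r' h2]

/-- Given a starting vector, columns of submaximal rate are eventually dominated, and each dominant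
entry gains the factor ρ^γ per period. The point is that ρ does not depend on row and residue. -/
theorem RatesAgree.orbitPeriodic (h : RatesAgree A) : OrbitPeriodic A := by
  obtain ⟨W, hW0, hWp, hW⟩ := exists_uniform A
  intro y
  have hg0 : 0 < jointCyclicity A := jointCyclicity_pos A
  have hshift : ∀ t, t + jointCyclicity A ≡ t [MOD jointCyclicity A] := fun t => by
    simp [Nat.ModEq]
  obtain ⟨ρ, hρ⟩ : ∃ ρ, ∀ i t, (∀ j, y j ≠ 0 → rate A i j t ≤ ρ) ∧
      ((∀ j, y j ≠ 0 → rate A i j t = 0) ∨ ∃ k, y k ≠ 0 ∧ rate A i k t = ρ ∧ ρ ≠ 0) := by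
    have hmax : ∀ i t, (∃ j, y j ≠ 0 ∧ rate A i j t ≠ 0) → ∃ k, y k ≠ 0 ∧ rate A i k t ≠ 0 ∧
        ∀ j, y j ≠ 0 → rate A i j t ≤ rate A i k t := by
      classical
      rintro i t ⟨j, hj, hj0⟩
      obtain ⟨k, hk, hmx⟩ := Finset.exists_max_image (Finset.univ.filter fun j => y j ≠ 0)
        (fun j => rate A i j t) ⟨j, by simpa using hj⟩
      simp only [Finset.mem_filter, Finset.mem_univ, true_and] at hk hmx
      exact ⟨k, hk, fun h0 => hj0 (le_zero_iff.1 (h0 ▸ hmx j hj)), hmx⟩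
    by_cases hex : ∃ i t, ∃ j, y j ≠ 0 ∧ rate A i j t ≠ 0
    · obtain ⟨i₀, t₀, hex⟩ := hex
      obtain ⟨k₀, hk₀, hne₀, hmx₀⟩ := hmax i₀ t₀ hex
      refine ⟨rate A i₀ k₀ t₀, fun i t => ?_⟩
      by_cases hit : ∃ j, y j ≠ 0 ∧ rate A i j t ≠ 0
      · obtain ⟨k, hk, hne, hmx⟩ := hmax i t hit
        -- Let k dominate at (i, t) and k₀ at (i₀, t₀) within the support. Each place has its
        -- dominant rate as joint rate of the columns k, k₀, so agreement for this pair suffices.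
        have h1 : max (rate A i k t) (rate A i k₀ t) = rate A i k t := max_eq_left (hmx k₀ hk₀)
        have h2 : max (rate A i₀ k t₀) (rate A i₀ k₀ t₀) = rate A i₀ k₀ t₀ :=
          max_eq_right (hmx₀ k hk)
        have heq := h k k₀ i i₀ t t₀ (by rwa [h1]) (by rwa [h2])
        rw [h1, h2] at heq
        exact ⟨fun j hj => heq ▸ hmx j hj, Or.inr ⟨k, hk, heq, hne₀⟩⟩
      · push Not at hit
        exact ⟨fun j hj => (hit j hj).symm ▸ zero_le, Or.inl hit⟩
    · push Not at hex
      exact ⟨0, fun i t => ⟨fun j hj => (hex i t j hj).le, Or.inl (hex i t)⟩⟩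
  have hdom : ∀ᶠ t in atTop, ∀ i j k, y k ≠ 0 → rate A i j t < rate A i k t →
      pow A t i j * y j ≤ pow A t i k * y k := by
    refine eventually_of_residues hg0 fun r => ?_
    have : ∀ᶠ t in atTop, ∀ i j k, y k ≠ 0 → rate A i j r < rate A i k r →
        W i j r * y j * rate A i j r ^ t ≤ W i k r * y k * rate A i k r ^ t := by
      refine eventually_all.2 fun i => eventually_all.2 fun j => eventually_all.2 fun k => ?_
      by_cases hyk : y k ≠ 0 ∧ rate A i j r < rate A i k r
      · have hWk : W i k r ≠ 0 := fun h0 => (bot_lt_of_lt hyk.2).ne' ((hW0 i k r).1 h0)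
        filter_upwards [eventually_mul_pow_le hyk.2 (W i j r * y j)
          (pos_iff_ne_zero.2 (mul_ne_zero hWk hyk.1))] with t ht _ _
        exact ht
      · exact Eventually.of_forall fun t h1 h2 => absurd ⟨h1, h2⟩ hyk
    filter_upwards [this, hW] with t ht hWt hr i j k hk hlt
    rw [hWt, hWt, hWp i j t r hr, hWp i k t r hr, rate_congr hr, rate_congr hr, mul_right_comm,
      mul_right_comm (W i k r)]
    rw [rate_congr hr, rate_congr hr] at hlt
    exact ht i j k hk hlt
  obtain ⟨T, hT⟩ := eventually_atTop.1 (hdom.and hW)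
  refine ⟨ρ, T, fun t ht => ?_⟩
  funext i
  obtain ⟨hd, hWt⟩ := hT t ht
  obtain ⟨hd', hWt'⟩ := hT (t + jointCyclicity A) (by omega)
  have hstep : ∀ j, pow A (t + jointCyclicity A) i j =
      rate A i j t ^ jointCyclicity A * pow A t i j := by
    intro j
    rw [hWt', hWt, hWp i j _ t (hshift t), rate_congr (hshift t), pow_add]
    ring
  rw [Pi.smul_apply, smul_eq_mul]
  simp only [mulVec]
  rw [NNReal.mul_finset_sup]
  obtain ⟨hle, hcase⟩ := hρ i t
  refine le_antisymm (Finset.sup_mono_fun fun j _ => ?_) (Finset.sup_le fun j _ => ?_)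
  · rw [hstep, mul_assoc]
    by_cases hj : y j = 0
    · simp [hj]
    · exact mul_le_mul_left (pow_le_pow_left' (hle j hj) _) _
  · by_cases hj : y j = 0
    · simp [hj]
    rcases hcase with h0 | ⟨k, hk, hkρ, hρ0⟩
    · rw [hWt i j, (hW0 i j t).2 (h0 j hj)]
      simp
    · rcases (hle j hj).eq_or_lt with he | hlt
      · refine le_trans (le_of_eq ?_) (Finset.le_sup (f := fun j =>
          pow A (t + jointCyclicity A) i j * y j) (Finset.mem_univ j))
        rw [hstep, he, mul_assoc]
      · refine le_trans ?_ (Finset.le_sup (f := fun j =>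
          pow A (t + jointCyclicity A) i j * y j) (Finset.mem_univ k))
        simp only [hstep, hkρ]
        rw [mul_assoc]
        exact mul_le_mul_right (hd i j k hk (hkρ ▸ hlt)) _

theorem orbitPeriodic_iff_ratesAgree : OrbitPeriodic A ↔ RatesAgree A :=
  ⟨OrbitPeriodic.ratesAgree, RatesAgree.orbitPeriodic⟩

end Orbits

/-! ### A finite criterion -/

section Criterion

variable {n : ℕ} {A : Matrix (Fin n) (Fin n) ℝ≥0}

/-- The power with exponent `n!` of the largest geometric mean of the cycles of length at most `n`
through `v`. -/
noncomputable def lamHat (A : Matrix (Fin n) (Fin n) ℝ≥0) (v : Fin n) : ℝ≥0 :=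
  (Finset.range n).sup fun k => pow A (k + 1) v v ^ ∏ m ∈ (Finset.range n).erase k, (m + 1)

open Classical in
/-- The largest value of `lamHat` at the nodes on walks of length `t` from `i` to `j`. -/
noncomputable def best (A : Matrix (Fin n) (Fin n) ℝ≥0) (t : ℕ) :
    Matrix (Fin n) (Fin n) ℝ≥0 :=
  fun i j => (Finset.univ.filter fun u => Thru A i u j t).sup (lamHat A)

open Classical in
/-- The zero-one matrix of the pairs of nodes connected by a walk of length `t`. -/
noncomputable def reach (A : Matrix (Fin n) (Fin n) ℝ≥0) (t : ℕ) :
    Matrix (Fin n) (Fin n) ℝ≥0 :=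
  fun i j => if pow A t i j = 0 then 0 else 1

theorem succ_mul_prod_erase {k : ℕ} (hk : k < n) :
    (k + 1) * ∏ m ∈ (Finset.range n).erase k, (m + 1) = n.factorial := by
  rw [Finset.mul_prod_erase (Finset.range n) (fun m => m + 1) (Finset.mem_range.2 hk),
    Finset.prod_range_add_one_eq_factorial]

theorem lamHat_le (A : Matrix (Fin n) (Fin n) ℝ≥0) (v : Fin n) :
    lamHat A v ≤ lam A v ^ n.factorial := by
  refine Finset.sup_le fun k hk => ?_
  rw [← succ_mul_prod_erase (Finset.mem_range.1 hk), pow_mul]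
  exact pow_le_pow_left' (pow_self_le A (k + 1) v) _

/-- At other nodes `lamHat` may be too small. This does no harm, since `best` takes the maximum
along walks, which can be led through a node of this kind in the same component. -/
theorem lamHat_eq {k : ℕ} {v : Fin n} (hk : 0 < k) (hkn : k ≤ n)
    (h : pow A k v v = lam A v ^ k) : lamHat A v = lam A v ^ n.factorial := by
  refine le_antisymm (lamHat_le A v) ?_
  obtain ⟨k, rfl⟩ := Nat.exists_eq_succ_of_ne_zero hk.ne'
  refine le_trans (le_of_eq ?_) (Finset.le_sup
    (f := fun k => pow A (k + 1) v v ^ ∏ m ∈ (Finset.range n).erase k, (m + 1))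
    (Finset.mem_range.2 hkn))
  rw [h, ← pow_mul, succ_mul_prod_erase hkn]

theorem lamHat_ne_zero_iff {v : Fin n} :
    lamHat A v ≠ 0 ↔ ∃ k, 0 < k ∧ k ≤ n ∧ pow A k v v ≠ 0 := by
  constructor
  · intro h
    by_contra! hk
    refine h (le_zero_iff.1 (Finset.sup_le fun k hkn => ?_))
    rw [hk (k + 1) (by omega) (Finset.mem_range.1 hkn), zero_pow]
    · exact (Finset.prod_pos fun m _ => Nat.succ_pos m).ne'
  · rintro ⟨k, hk, hkn, h⟩
    obtain ⟨k, rfl⟩ := Nat.exists_eq_succ_of_ne_zero hk.ne'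
    refine ((pow_pos h.bot_lt _).trans_le (Finset.le_sup
      (f := fun k => pow A (k + 1) v v ^ ∏ m ∈ (Finset.range n).erase k, (m + 1))
      (Finset.mem_range.2 hkn))).ne'

theorem Thru.le_best {i u j : Fin n} {t : ℕ} (h : Thru A i u j t) :
    lamHat A u ≤ best A t i j := by
  classical
  exact Finset.le_sup (f := lamHat A) (by simpa using h)

theorem best_le {i j : Fin n} {t : ℕ} {x : ℝ≥0} (h : ∀ u, Thru A i u j t → lamHat A u ≤ x) :
    best A t i j ≤ x := by
  classical
  exact Finset.sup_le fun u hu => h u (Finset.mem_filter.1 hu).2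

/-- Cut closed walks of lengths divisible by L out of both halves until each has fewer than n·L
edges. The deficit up to t is then a multiple of L and is filled by going round the closed walk at
i. -/
theorem Thru.of_modEq {i u j : Fin n} {s t L : ℕ} (h : Thru A i u j s) (hL : 0 < L)
    (hi : pow A L i i ≠ 0) (hm : s ≡ t [MOD L]) (ht : 2 * (n * L) ≤ t) : Thru A i u j t := by
  obtain ⟨a, b, rfl, ha, hb⟩ := h
  -- Only the lengths from `exists_short` matter here, so any upper bound for λ serves as its
  -- normalizing constant.
  have hl : ∀ w, lam A w ≤ Finset.univ.sup (lam A) := fun w => Finset.le_sup (Finset.mem_univ w)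
  obtain ⟨a', ha', hma, ha0, -⟩ := exists_short hL (fun w _ _ _ => hl w) ha
  obtain ⟨b', hb', hmb, hb0, -⟩ := exists_short hL (fun w _ _ _ => hl w) hb
  obtain ⟨m, hm⟩ := (Nat.modEq_iff_dvd' (show a' + b' ≤ t by omega)).1 ((hma.add hmb).trans hm)
  have : t = m * L + (a' + b') := by rw [mul_comm, ← hm]; omega
  rw [this]
  exact Thru.prepend (pow_mul_ne_zero hi m) ⟨a', b', rfl, ha0, hb0⟩

/-- On rows that belong to nodes on cycles, the entries of `best` are the growth rates. -/
theorem best_eq_rate_pow {i j : Fin n} {L s t : ℕ} (hL : 0 < L) (hLn : L ≤ n)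
    (hi : pow A L i i ≠ 0) (hm : s ≡ t [MOD L]) (hs : 2 * n ^ 2 ≤ s) :
    best A s i j = rate A i j t ^ n.factorial := by
  have hg0 : 0 < jointCyclicity A := jointCyclicity_pos A
  set g := jointCyclicity A with hg
  refine le_antisymm (best_le fun u hu => ?_) ?_
  · refine (lamHat_le A u).trans (pow_le_pow_left' ?_ _)
    -- The number t + g·L·s is at least s and congruent to t modulo both g and L. Circling at i
    -- prolongs a walk of length s to this length without losing u, which puts it in the residue
    -- class of t modulo γ.
    have h1 : s ≤ t + g * L * s := by
      have : 1 ≤ g * L := Nat.mul_pos hg0 hL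
      nlinarith
    have h2 : s ≡ t + g * L * s [MOD L] := by
      refine hm.trans ?_
      rw [show g * L * s = L * (g * s) by ring]
      simp [Nat.ModEq]
    obtain ⟨m, hm'⟩ := (Nat.modEq_iff_dvd' h1).1 h2
    refine (Thru.prepend (pow_mul_ne_zero hi m) hu).lam_le_rate ?_
    rw [show m * L + s = t + g * (L * s) by rw [mul_comm m, ← hm', ← mul_assoc]; omega]
    simp [Nat.ModEq, ← hg]
  · by_cases h0 : rate A i j t = 0
    · rw [h0, zero_pow (Nat.factorial_ne_zero n)]
      exact zero_le
    obtain ⟨v, a, ha, hv, hvl⟩ := exists_lam_eq_rate h0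
    obtain ⟨u, hsame, hc, hul, k, hk, hkn, hpk⟩ := exists_crit (v := v) (by rw [hvl]; exact h0)
    obtain ⟨a', ha', hu⟩ := hv.sameComp hsame hg0
    obtain ⟨N, hN⟩ := exists_crit_walks hc
    -- Conversely, critical closed walks at u stretch the walk of length a' to t + g·L·(a' + N),
    -- which is congruent to t modulo L; the summand N makes their total length large enough to
    -- exist.
    have hle : a' + N ≤ t + g * L * (a' + N) := by
      have : 1 ≤ g * L := Nat.mul_pos hg0 hL
      nlinarith
    obtain ⟨m, hm'⟩ := (Nat.modEq_iff_dvd' (n := g) (show a' ≤ t + g * L * (a' + N) by omega)).1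
      ((ha'.trans ha).trans (by rw [mul_assoc]; simp [Nat.ModEq]))
    have hcl := hN (g * m) (by omega) (dvd_mul_right _ _)
    have hins := hu.insert (t := g * m) (by
      rw [hcl, hul, hvl]; exact pow_ne_zero _ h0)
    rw [show a' + g * m = t + L * (g * (a' + N)) by
      rw [← hm', show L * (g * (a' + N)) = g * L * (a' + N) by ring]; omega] at hins
    have := (hins.of_modEq hL hi (show _ ≡ s [MOD L] from
      (show t + L * (g * (a' + N)) ≡ t [MOD L] by simp [Nat.ModEq]).trans hm.symm)
      (le_trans (by nlinarith) hs)).le_best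
    rwa [lamHat_eq hk hkn (hul.symm ▸ hpk), hul, hvl] at this

theorem max_pow_eq (x y : ℝ≥0) (N : ℕ) : max (x ^ N) (y ^ N) = max x y ^ N := by
  rcases le_total x y with h | h
  · rw [max_eq_right h, max_eq_right (pow_le_pow_left' h N)]
  · rw [max_eq_left h, max_eq_left (pow_le_pow_left' h N)]

/-- The values of `best` in any two columns, taken together, agree in all rows that belong to nodes
on cycles and for all `t` with `T ≤ t < T + n`, as far as they do not vanish. -/
def BestAgree (A : Matrix (Fin n) (Fin n) ℝ≥0) (T : ℕ) : Prop :=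
  ∀ j k i i' s s', s < n → s' < n → lamHat A i ≠ 0 → lamHat A i' ≠ 0 →
    max (best A (T + s) i j) (best A (T + s) i k) ≠ 0 →
    max (best A (T + s') i' j) (best A (T + s') i' k) ≠ 0 →
    max (best A (T + s) i j) (best A (T + s) i k) =
      max (best A (T + s') i' j) (best A (T + s') i' k)

/-- Take a walk from i to j that attains the larger rate at a critical node u. Its initial part i →
u shows that no rate in row u, for the remaining length b, exceeds the one in row i, while u itself
keeps the rate of column j. So the maximum over both columns is the same in row u. -/
theorem exists_recurrent_row {i j k : Fin n} {r : ℕ}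
    (h : max (rate A i j r) (rate A i k r) ≠ 0) :
    ∃ v s, (∃ L, 0 < L ∧ L ≤ n ∧ pow A L v v ≠ 0) ∧
      max (rate A v j s) (rate A v k s) = max (rate A i j r) (rate A i k r) := by
  wlog hjk : rate A i k r ≤ rate A i j r generalizing j k
  · have := this (j := k) (k := j) (by rwa [max_comm]) (le_of_not_ge hjk)
    simpa only [max_comm] using this
  rw [max_eq_left hjk] at h ⊢
  obtain ⟨v, t, ht, hv, hvl⟩ := exists_lam_eq_rate h
  obtain ⟨u, hs, -, hul, L, hL, hLn, hLu⟩ := exists_crit (v := v) (by rw [hvl]; exact h)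
  obtain ⟨t', ht', a, b, rfl, ha, hb⟩ := hv.sameComp hs (jointCyclicity_pos A)
  have hmono : ∀ x, rate A u x b ≤ rate A i x r := by
    intro x
    by_cases h0 : rate A u x b = 0
    · rw [h0]; exact zero_le
    obtain ⟨w, c, hc, hw, hwl⟩ := exists_lam_eq_rate h0
    rw [← hwl]
    exact (hw.prepend ha).lam_le_rate ((hc.add_left a).trans (ht'.trans ht))
  have hu : rate A i j r ≤ rate A u j b := by
    rw [← hvl, ← hul]
    exact Thru.lam_le_rate (t := b) ⟨0, b, zero_add b, by simp [pow], hb⟩ rfl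
  refine ⟨u, b, ⟨L, hL, hLn, ?_⟩,
    le_antisymm (max_le (hmono j) ((hmono k).trans hjk)) (le_max_of_le_left hu)⟩
  rw [hLu, hvl]
  exact pow_ne_zero _ h

/-- This removes γ: a row on a cycle of length L ≤ n depends only on the length modulo L, and T, …,
T + n - 1 meet every such class. Taking powers with exponent n! is injective and commutes with
maxima. -/
theorem ratesAgree_iff_bestAgree {T : ℕ} (hT : 2 * n ^ 2 ≤ T) : RatesAgree A ↔ BestAgree A T := by
  have hf := Nat.factorial_ne_zero n
  constructor
  · intro h j k i i' s s' _ _ hi hi'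
    obtain ⟨L, hL, hLn, hLi⟩ := lamHat_ne_zero_iff.1 hi
    obtain ⟨L', hL', hLn', hLi'⟩ := lamHat_ne_zero_iff.1 hi'
    have e : ∀ x, best A (T + s) i x = rate A i x (T + s) ^ n.factorial := fun x =>
      best_eq_rate_pow hL hLn hLi rfl (by omega)
    have e' : ∀ x, best A (T + s') i' x = rate A i' x (T + s') ^ n.factorial := fun x =>
      best_eq_rate_pow hL' hLn' hLi' rfl (by omega)
    simp only [e, e', max_pow_eq]
    intro h1 h2
    rw [h j k i i' _ _ (fun h0 => h1 (by rw [h0, zero_pow hf]))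
      (fun h0 => h2 (by rw [h0, zero_pow hf]))]
  · intro h j k i i' r r' h1 h2
    have key : ∀ i r, max (rate A i j r) (rate A i k r) ≠ 0 → ∃ v s, s < n ∧ lamHat A v ≠ 0 ∧
        max (best A (T + s) v j) (best A (T + s) v k) =
          max (rate A i j r) (rate A i k r) ^ n.factorial := by
      intro i r h0
      obtain ⟨v, t, ⟨L, hL, hLn, hLv⟩, he⟩ := exists_recurrent_row h0
      -- This is the residue of t - T modulo L, written without subtraction from t.
      refine ⟨v, (t + (L - 1) * T) % L, (Nat.mod_lt _ hL).trans_le hLn,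
        lamHat_ne_zero_iff.2 ⟨L, hL, hLn, hLv⟩, ?_⟩
      have hm : T + (t + (L - 1) * T) % L ≡ t [MOD L] := by
        refine ((Nat.mod_modEq _ _).add_left T).trans ?_
        obtain ⟨L, rfl⟩ := Nat.exists_eq_succ_of_ne_zero hL.ne'
        rw [show T + (t + (L.succ - 1) * T) = t + L.succ * T by
          simp only [Nat.succ_sub_one, Nat.succ_mul]; ring]
        simp [Nat.ModEq]
      rw [best_eq_rate_pow hL hLn hLv hm (by omega), best_eq_rate_pow hL hLn hLv hm (by omega),
        max_pow_eq, he]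
    obtain ⟨v, s, hs, hv, he⟩ := key i r h1
    obtain ⟨v', s', hs', hv', he'⟩ := key i' r' h2
    have := h j k v v' s s' hs hs' hv hv' (he ▸ pow_ne_zero _ h1) (he' ▸ pow_ne_zero _ h2)
    rw [he, he'] at this
    exact (pow_left_inj₀ zero_le zero_le hf).1 this

/-! ### Recurrences for the matrices of the criterion -/

theorem reach_one (A : Matrix (Fin n) (Fin n) ℝ≥0) (i j : Fin n) :
    reach A 1 i j = if A i j ≤ 0 then 0 else 1 := by
  simp only [reach, pow_one', nonpos_iff_eq_zero]

theorem reach_add (A : Matrix (Fin n) (Fin n) ℝ≥0) (s t : ℕ) :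
    reach A (s + t) = mul (reach A s) (reach A t) := by
  funext i j
  refine le_antisymm ?_ (Finset.sup_le fun u _ => ?_)
  · by_cases h : pow A (s + t) i j = 0
    · rw [reach, if_pos h]; exact zero_le
    · obtain ⟨u, hu⟩ := exists_pow_add_eq A s t i j
      rw [hu] at h
      refine le_trans ?_ (le_mul _ _ i u j)
      simp only [reach, if_neg (left_ne_zero_of_mul h), if_neg (right_ne_zero_of_mul h), mul_one]
      split_ifs <;> simp
  · by_cases h1 : pow A s i u = 0
    · simp [reach, h1]
    by_cases h2 : pow A t u j = 0
    · simp [reach, h2]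
    simp [reach, h1, h2, pow_add_ne_zero h1 h2]

/-- A node on a walk of length s + t is met in the first s or in the last t steps; the other part
only has to exist. This is a product rule, with `best` in the role of the derivative of `reach`. -/
theorem best_add (A : Matrix (Fin n) (Fin n) ℝ≥0) (s t : ℕ) (i j : Fin n) :
    best A (s + t) i j =
      max (mul (best A s) (reach A t) i j) (mul (reach A s) (best A t) i j) := by
  refine le_antisymm (best_le ?_) (max_le (Finset.sup_le fun k _ => ?_)
    (Finset.sup_le fun k _ => ?_))
  · rintro u ⟨a, b, hab, ha, hb⟩
    rcases le_total a s with h | h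
    · obtain ⟨c, rfl⟩ := Nat.exists_eq_add_of_le h
      obtain rfl : b = c + t := by omega
      obtain ⟨w, hw⟩ := exists_pow_add_eq A c t u j
      rw [hw] at hb
      refine le_max_of_le_left (le_trans ?_ (le_mul _ _ i w j))
      rw [reach, if_neg (right_ne_zero_of_mul hb), mul_one]
      exact Thru.le_best ⟨a, c, rfl, ha, left_ne_zero_of_mul hb⟩
    · obtain ⟨c, rfl⟩ := Nat.exists_eq_add_of_le h
      obtain rfl : t = c + b := by omega
      obtain ⟨w, hw⟩ := exists_pow_add_eq A s c i u
      rw [hw] at ha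
      refine le_max_of_le_right (le_trans ?_ (le_mul _ _ i w j))
      rw [reach, if_neg (left_ne_zero_of_mul ha), one_mul]
      exact Thru.le_best ⟨c, b, rfl, right_ne_zero_of_mul ha, hb⟩
  · by_cases h : pow A t k j = 0
    · simp [reach, h]
    · rw [reach, if_neg h, mul_one]
      exact best_le fun u hu => (hu.append h).le_best
  · by_cases h : pow A s i k = 0
    · simp [reach, h]
    · rw [reach, if_neg h, one_mul]
      exact best_le fun u hu => (hu.prepend h).le_best

theorem best_one (A : Matrix (Fin n) (Fin n) ℝ≥0) (i j : Fin n) :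
    best A 1 i j = max (lamHat A i * reach A 1 i j) (lamHat A j * reach A 1 i j) := by
  have hone : ∀ i j, pow A 0 i j ≠ 0 → i = j := fun i j h => by
    by_contra hne
    exact h (by rw [pow]; exact Matrix.one_apply_ne hne)
  refine le_antisymm (best_le ?_) ?_
  · rintro u ⟨a, b, hab, ha, hb⟩
    obtain ⟨rfl, rfl⟩ | ⟨rfl, rfl⟩ : a = 0 ∧ b = 1 ∨ a = 1 ∧ b = 0 := by omega
    · obtain rfl := hone _ _ ha
      exact le_max_of_le_left (by rw [reach, if_neg hb, mul_one])
    · obtain rfl := hone _ _ hb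
      exact le_max_of_le_right (by rw [reach, if_neg ha, mul_one])
  · by_cases h : pow A 1 i j = 0
    · simp [reach, h]
    · rw [reach, if_neg h, mul_one, mul_one]
      exact max_le (Thru.le_best ⟨0, 1, rfl, by simp [pow], h⟩)
        (Thru.le_best ⟨1, 0, rfl, h, by simp [pow]⟩)

end Criterion

/-! ### Reasoning about programs -/

section Logic

/-- Between the stores `s` and `s'`, only the index registers in `R` and the real arrays in `D`
have changed. -/
def Frame (R D : Finset ℕ) (s s' : Store) : Prop :=
  (∀ x, x ∉ R → s'.reg x = s.reg x) ∧ ∀ a, a ∉ D → s'.real a = s.real a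

theorem Frame.refl (R D : Finset ℕ) (s : Store) : Frame R D s s := ⟨fun _ _ => rfl, fun _ _ => rfl⟩

theorem Frame.trans {R D : Finset ℕ} {s₀ s₁ s₂ : Store} (h : Frame R D s₀ s₁)
    (h' : Frame R D s₁ s₂) : Frame R D s₀ s₂ :=
  ⟨fun x hx => (h'.1 x hx).trans (h.1 x hx), fun a ha => (h'.2 a ha).trans (h.2 a ha)⟩

theorem Frame.mono {R D R' D' : Finset ℕ} {s s' : Store} (h : Frame R D s s') (hR : R ⊆ R')
    (hD : D ⊆ D') : Frame R' D' s s' :=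
  ⟨fun x hx => h.1 x fun h' => hx (hR h'), fun a ha => h.2 a fun h' => ha (hD h')⟩

theorem Frame.setReg {R D : Finset ℕ} {s s' : Store} (h : Frame R D s s') {x : ℕ} (hx : x ∈ R)
    (v : ℕ) : Frame R D s (s'.setReg x v) :=
  ⟨fun y hy => by
    have : y ≠ x := fun h' => hy (h' ▸ hx)
    simp only [Store.setReg, if_neg this]
    exact h.1 y hy, h.2⟩

theorem Frame.setReal {R D : Finset ℕ} {s s' : Store} (h : Frame R D s s') {p : Ref}
    (hp : p.arr ∈ D) (v : ℝ≥0) : Frame R D s (s'.setReal p v) :=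
  ⟨h.1, fun a ha => by
    have : a ≠ p.arr := fun h' => ha (h' ▸ hp)
    simp only [Store.setReal, this, false_and, if_false]
    exact h.2 a ha⟩

/-- Started in `s`, the program `P` stops after at most `k` operations, changes only index registers
in `R` and real arrays in `D`, and leaves real arrays that satisfy `Q`. -/
def Run (R D : Finset ℕ) (P : Prog) (k : ℕ) (s : Store) (Q : (ℕ → ℕ → ℕ → ℝ≥0) → Prop) : Prop :=
  ∃ t s', Exec P s t s' ∧ t ≤ k ∧ Frame R D s s' ∧ Q s'.real

variable {R D : Finset ℕ} {P P' : Prog} {k k' : ℕ} {s : Store}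
  {Q Q' : (ℕ → ℕ → ℕ → ℝ≥0) → Prop}

theorem Run.mono {R' D' : Finset ℕ} (h : Run R D P k s Q) (hR : R ⊆ R') (hD : D ⊆ D')
    (hk : k ≤ k') (hQ : ∀ s', Frame R D s s' → Q s'.real → Q' s'.real) : Run R' D' P k' s Q' := by
  obtain ⟨t, s', he, ht, hf, hq⟩ := h
  exact ⟨t, s', he, ht.trans hk, hf.mono hR hD, hQ s' hf hq⟩

theorem Run.weaken {R' D' : Finset ℕ} (h : Run R D P k s Q) (hR : R ⊆ R') (hD : D ⊆ D')
    (hk : k ≤ k') : Run R' D' P k' s Q :=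
  h.mono hR hD hk fun _ _ h => h

theorem Run.seq (h : Run R D P k s Q) (h' : ∀ s', Frame R D s s' → Q s'.real → Run R D P' k' s' Q') :
    Run R D (.seq P P') (k + k') s Q' := by
  obtain ⟨t, s', he, ht, hf, hq⟩ := h
  obtain ⟨t', s'', he', ht', hf', hq'⟩ := h' s' hf hq
  exact ⟨t + t', s'', he.seq he', by omega, hf.trans hf', hq'⟩

theorem Run.ite {b : Test} (h : b.Holds s → Run R D P k s Q)
    (h' : ¬ b.Holds s → Run R D P' k s Q) : Run R D (.ite b P P') (1 + k) s Q := by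
  by_cases hb : b.Holds s
  · obtain ⟨t, s', he, ht, hf, hq⟩ := h hb
    exact ⟨1 + t, s', .iteTrue hb he, by omega, hf, hq⟩
  · obtain ⟨t, s', he, ht, hf, hq⟩ := h' hb
    exact ⟨1 + t, s', .iteFalse hb he, by omega, hf, hq⟩

theorem Run.realOp (c : Instr) (p : Ref) (v : ℝ≥0) (hc : c.apply s = s.setReal p v) (hp : p.arr ∈ D)
    (hQ : Q (s.setReal p v).real) : Run R D (.op c) 1 s Q :=
  ⟨1, c.apply s, .op c s, le_rfl, hc ▸ (Frame.refl R D s).setReal hp v, hc ▸ hQ⟩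

/-- `for i = 0, …, b - 1 do P`, where `i` and `b` are index registers. -/
def Prog.forLoop (i b : ℕ) (P : Prog) : Prog :=
  .seq (.op (.zero i)) (.while (.lt i b) (.seq P (.op (.succ i))))

/-- Number of operations of a loop with `N` rounds of at most `k` operations each. -/
def forCost (N k : ℕ) : ℕ := N * (k + 2) + 2

theorem Run.forLoop {i b N : ℕ} (hN : s.reg b = N) (hi : i ∉ R) (hb : b ∉ insert i R)
    (I : ℕ → (ℕ → ℕ → ℕ → ℝ≥0) → Prop) (h0 : I 0 s.real)
    (hstep : ∀ m < N, ∀ s', Frame (insert i R) D s s' → s'.reg i = m → I m s'.real →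
      Run R D P k s' (I (m + 1))) :
    Run (insert i R) D (.forLoop i b P) (forCost (N) k) s (I (N)) := by
  have hii : i ∈ insert i R := Finset.mem_insert_self i R
  have main : ∀ r m s', m + r = N → Frame (insert i R) D s s' → s'.reg i = m →
      I m s'.real → ∃ t s'', Exec (.while (.lt i b) (.seq P (.op (.succ i)))) s' t s'' ∧
        t ≤ r * (k + 2) + 1 ∧ Frame (insert i R) D s s'' ∧ I (N) s''.real := by
    intro r
    induction r with
    | zero =>
      intro m s' hm hf hs hI
      refine ⟨1, s', .whileFalse ?_, by omega, hf, by rwa [← hm]⟩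
      simp only [Test.Holds, hs, hf.1 b hb, hN]
      omega
    | succ r ih =>
      intro m s' hm hf hs hI
      obtain ⟨t, s₁, he, ht, hf₁, hI₁⟩ := hstep m (by omega) s' hf hs hI
      have hs₁ : s₁.reg i = m := (hf₁.1 i hi).trans hs
      obtain ⟨u, s₂, he₂, hu, hf₂, hI₂⟩ := ih (m + 1) (s₁.setReg i (s₁.reg i + 1)) (by omega)
        ((hf.trans (hf₁.mono (Finset.subset_insert i R) subset_rfl)).setReg hii _)
        (by simp [Store.setReg, hs₁]) hI₁
      refine ⟨1 + (t + 1) + u, s₂, .whileTrue ?_ (he.seq (.op (.succ i) s₁)) he₂, ?_, hf₂, hI₂⟩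
      · simp only [Test.Holds, hs, hf.1 b hb, hN]
        omega
      · rw [Nat.succ_mul]; omega
  obtain ⟨t, s', he, ht, hf, hI⟩ := main (N) 0 (s.setReg i 0) (by omega)
    ((Frame.refl _ D s).setReg hii 0) (by simp [Store.setReg]) h0
  exact ⟨1 + t, s', .seq (.op (.zero i) s) he, by unfold forCost; omega, hf, hI⟩

theorem forCost_mono {N N' : ℕ} (hN : N ≤ N') (hk : k ≤ k') : forCost N k ≤ forCost N' k' := by
  unfold forCost; gcongr

/-- The leading `n × n` block of an array holds the matrix `M`. -/
def Rep {n : ℕ} (a : ℕ → ℕ → ℝ≥0) (M : Matrix (Fin n) (Fin n) ℝ≥0) : Prop :=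
  ∀ i j : Fin n, a i j = M i j

/-- Loops over all rows and columns; the index registers are `1` and `2`. -/
def Prog.matLoop (P : Prog) : Prog := .forLoop 1 0 (.forLoop 2 0 P)

/-- Number of operations of a loop over all rows and columns. -/
def matCost (n k : ℕ) : ℕ := forCost n (forCost n k)

/-- Every entry is written only in its own round, so the body may assume that it still has its
initial value. This is what allows routines that accumulate into their target. -/
theorem Run.matLoop {n : ℕ} {d : ℕ} (hn : s.reg 0 = n) (h0 : 0 ∉ R) (h1 : 1 ∉ R) (h2 : 2 ∉ R)
    (f : Matrix (Fin n) (Fin n) ℝ≥0)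
    (hP : ∀ (i j : Fin n) s', Frame (insert 1 (insert 2 R)) D s s' → s'.reg 1 = i → s'.reg 2 = j →
      s'.real d i j = s.real d i j → Run R D P k s' fun m => m d i j = f i j ∧
        ∀ x y, ¬ (x = (i : ℕ) ∧ y = (j : ℕ)) → m d x y = s'.real d x y) :
    Run (insert 1 (insert 2 R)) D P.matLoop (matCost n k) s fun m => Rep (m d) f := by
  refine (Run.forLoop hn (R := insert 2 R) (by simp [h1]) (by simp [h0])
    (fun x m => ∀ i j : Fin n, m d i j = if (i : ℕ) < x then f i j else s.real d i j)
    (by simp) (k := forCost n k) ?_).mono subset_rfl subset_rfl le_rfl ?_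
  · intro x hx s₁ hf₁ hs₁ hI₁
    have hr : s₁.reg 0 = n := (hf₁.1 0 (by simp [h0])).trans hn
    refine (Run.forLoop hr h2 (by simp [h0])
      (fun y m => ∀ i j : Fin n, m d i j =
        if (i : ℕ) < x ∨ (i : ℕ) = x ∧ (j : ℕ) < y then f i j else s.real d i j)
      (by simpa using hI₁) (k := k) ?_).mono subset_rfl subset_rfl le_rfl ?_
    · intro y hy s₂ hf₂ hs₂ hI₂
      have hx₂ : s₂.reg 1 = x := (hf₂.1 1 (by simp [h1])).trans hs₁
      have hold := hI₂ ⟨x, hx⟩ ⟨y, hy⟩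
      rw [if_neg (by simp)] at hold
      refine (hP ⟨x, hx⟩ ⟨y, hy⟩ s₂
        (hf₁.trans (hf₂.mono (Finset.subset_insert _ _) subset_rfl)) hx₂ hs₂ hold).mono
        subset_rfl subset_rfl le_rfl ?_
      rintro s₃ - ⟨hq, hq'⟩ i j
      by_cases hij : (i : ℕ) = x ∧ (j : ℕ) = y
      · obtain ⟨hi, hj⟩ := hij
        obtain rfl : i = ⟨x, hx⟩ := Fin.ext hi
        obtain rfl : j = ⟨y, hy⟩ := Fin.ext hj
        rw [hq, if_pos (Or.inr ⟨rfl, Nat.lt_succ_self _⟩)]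
      · rw [hq' i j hij, hI₂]
        exact if_congr (by omega) rfl rfl
    · intro s₃ _ hI i j
      rw [hI]
      exact if_congr (by omega) rfl rfl
  · intro s₁ _ hI i j
    rw [hI, if_pos i.2]

end Logic

/-! ### Matrix routines -/

section Routines

variable {n : ℕ} {s : Store}

theorem setReal_real (s : Store) (p : Ref) (v : ℝ≥0) (a i j : ℕ) : (s.setReal p v).real a i j =
    if a = p.arr ∧ i = s.reg p.row ∧ j = s.reg p.col then v else s.real a i j := rfl

theorem setReal_entry {d i j : ℕ} (h1 : s.reg 1 = i) (h2 : s.reg 2 = j) (v : ℝ≥0) :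
    (s.setReal ⟨d, 1, 2⟩ v).real d i j = v ∧ ∀ x y, ¬ (x = i ∧ y = j) →
      (s.setReal ⟨d, 1, 2⟩ v).real d x y = s.real d x y := by
  subst h1 h2
  exact ⟨if_pos ⟨rfl, rfl, rfl⟩, fun x y h => if_neg fun h' => h h'.2⟩

/-- Set all entries of the array `d` to `0`. -/
def Prog.zeroMat (d : ℕ) : Prog := .matLoop (.op (.realZero ⟨d, 1, 2⟩))

theorem run_zeroMat (hn : s.reg 0 = n) (d : ℕ) :
    Run {1, 2} {d} (.zeroMat d) (matCost n 1) s
      fun m => Rep (m d) (0 : Matrix (Fin n) (Fin n) ℝ≥0) :=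
  Run.matLoop (R := ∅) hn (by simp) (by simp) (by simp) _ fun _ _ _ _ h1 h2 _ =>
    Run.realOp _ ⟨d, 1, 2⟩ 0 rfl (by simp) (setReal_entry h1 h2 0)

/-- Copy the array `a` to the array `d`. -/
def Prog.copyMat (d a : ℕ) : Prog := .matLoop (.op (.realCopy ⟨d, 1, 2⟩ ⟨a, 1, 2⟩))

theorem run_copyMat (hn : s.reg 0 = n) {d a : ℕ} (h : a ≠ d) {M : Matrix (Fin n) (Fin n) ℝ≥0}
    (hM : Rep (s.real a) M) :
    Run {1, 2} {d} (.copyMat d a) (matCost n 1) s fun m => Rep (m d) M :=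
  Run.matLoop (R := ∅) hn (by simp) (by simp) (by simp) _ fun i j s' hf h1 h2 _ => by
    refine Run.realOp _ ⟨d, 1, 2⟩ (s'.getReal ⟨a, 1, 2⟩) rfl (by simp) ?_
    rw [show s'.getReal ⟨a, 1, 2⟩ = M i j by
      rw [Store.getReal, h1, h2, hf.2 a (by simpa using h), hM]]
    exact setReal_entry h1 h2 _

/-- Replace the array `d` by its maximum with the product of the arrays `a` and `b`. -/
def Prog.mulAcc (d a b : ℕ) : Prog :=
  .matLoop (.forLoop 3 0 (.seq (.op (.realMul ⟨10, 9, 9⟩ ⟨a, 1, 3⟩ ⟨b, 3, 2⟩))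
    (.op (.realMax ⟨d, 1, 2⟩ ⟨d, 1, 2⟩ ⟨10, 9, 9⟩))))

theorem filter_lt_succ {x : ℕ} (hx : x < n) :
    (Finset.univ.filter fun k : Fin n => (k : ℕ) < x + 1) =
      insert ⟨x, hx⟩ (Finset.univ.filter fun k : Fin n => (k : ℕ) < x) := by
  ext k
  simp only [Finset.mem_filter, Finset.mem_univ, true_and, Finset.mem_insert, Fin.ext_iff]
  omega

theorem filter_lt_self : (Finset.univ.filter fun k : Fin n => (k : ℕ) < n) = Finset.univ := by
  ext k
  simp

theorem run_mulAcc (hn : s.reg 0 = n) {d a b : ℕ} (had : a ≠ d) (hbd : b ≠ d) (ha : a ≠ 10)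
    (hb : b ≠ 10) (hd : d ≠ 10) {C M M' : Matrix (Fin n) (Fin n) ℝ≥0} (hC : Rep (s.real d) C)
    (hM : Rep (s.real a) M) (hM' : Rep (s.real b) M') :
    Run {1, 2, 3} {d, 10} (.mulAcc d a b) (matCost n (forCost n 2)) s
      fun m => Rep (m d) fun i j => max (C i j) (mul M M' i j) := by
  refine Run.matLoop (R := {3}) hn (by simp) (by simp) (by simp) _ fun i j s₁ hf₁ h1 h2 hold => ?_
  refine (Run.forLoop (R := ∅) (k := 2) ((hf₁.1 0 (by simp)).trans hn) (by simp) (by simp)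
    (fun x m => m d i j = max (C i j)
        ((Finset.univ.filter fun k : Fin n => (k : ℕ) < x).sup fun k => M i k * M' k j) ∧
      ∀ x y, ¬ (x = (i : ℕ) ∧ y = (j : ℕ)) → m d x y = s₁.real d x y) ?_ ?_).mono
    subset_rfl subset_rfl le_rfl ?_
  · refine ⟨?_, fun _ _ _ => rfl⟩
    rw [hold, hC]
    simp
  · intro x hx s₂ hf₂ h3 hI
    refine Run.seq (k := 1) (k' := 1) (Run.realOp _ ⟨10, 9, 9⟩ (M i ⟨x, hx⟩ * M' ⟨x, hx⟩ j) ?_ (by simp)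
      (Q := fun m => m 10 (s₂.reg 9) (s₂.reg 9) = M i ⟨x, hx⟩ * M' ⟨x, hx⟩ j ∧
        m d = s₂.real d) ?_) ?_
    · simp only [Instr.apply, Store.getReal]
      rw [hf₂.1 1 (by simp), hf₂.1 2 (by simp), h1, h2, h3,
        hf₂.2 a (by simp [ha, had]), hf₂.2 b (by simp [hb, hbd]), hf₁.2 a (by simp [ha, had]),
        hf₁.2 b (by simp [hb, hbd])]
      rw [hM i ⟨x, hx⟩, hM' ⟨x, hx⟩ j]
    · refine ⟨if_pos ⟨rfl, rfl, rfl⟩, ?_⟩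
      funext x y
      exact if_neg fun h => hd h.1
    · intro s₃ hf₃ hQ
      have h1' : s₃.reg 1 = i := (hf₃.1 1 (by simp)).trans ((hf₂.1 1 (by simp)).trans h1)
      have h2' : s₃.reg 2 = j := (hf₃.1 2 (by simp)).trans ((hf₂.1 2 (by simp)).trans h2)
      refine Run.realOp _ ⟨d, 1, 2⟩ _ rfl (by simp) ?_
      have he := setReal_entry (d := d) h1' h2'
        (max (s₃.getReal ⟨d, 1, 2⟩) (s₃.getReal ⟨10, 9, 9⟩))
      refine ⟨he.1.trans ?_, fun x y hxy => (he.2 x y hxy).trans ?_⟩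
      · simp only [Store.getReal]
        rw [h1', h2', hf₃.1 9 (by simp), hQ.1, hQ.2, hI.1, filter_lt_succ hx, Finset.sup_insert,
          max_assoc]
        exact congrArg _ (max_comm _ _)
      · rw [hQ.2, hI.2 x y hxy]
  · rintro s₂ - ⟨h, h'⟩
    refine ⟨h.trans ?_, h'⟩
    rw [filter_lt_self]
    rfl

/-- Multiply the pair of matrices in the arrays `5` and `6` by the pair in the arrays `u` and
`w`, where `(B, V) * (B', V') = (B * B', max (V * B') (B * V'))`. -/
def Prog.pairMul (u w : ℕ) : Prog :=
  .seq (.zeroMat 7) <| .seq (.mulAcc 7 5 u) <| .seq (.zeroMat 8) <| .seq (.mulAcc 8 6 u) <|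
    .seq (.mulAcc 8 5 w) <| .seq (.copyMat 5 7) (.copyMat 6 8)

/-- Number of operations of `Prog.pairMul`. -/
def pairCost (n : ℕ) : ℕ := 4 * matCost n 1 + 3 * matCost n (forCost n 2)

/-- Both products are assembled in the scratch arrays 7 and 8 and copied back only at the end. So
the second factor may be the pair in 5 and 6 itself, which gives squaring. -/
theorem run_pairMul {A : Matrix (Fin n) (Fin n) ℝ≥0} (hn : s.reg 0 = n) {u w : ℕ}
    (hu : u ∉ ({7, 8, 10} : Finset ℕ)) (hw : w ∉ ({7, 8, 10} : Finset ℕ)) {x y : ℕ}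
    (hB : Rep (s.real 5) (reach A x)) (hV : Rep (s.real 6) (best A x))
    (hU : Rep (s.real u) (reach A y)) (hW : Rep (s.real w) (best A y)) :
    Run {1, 2, 3} {5, 6, 7, 8, 10} (.pairMul u w) (pairCost n) s
      fun m => Rep (m 5) (reach A (x + y)) ∧ Rep (m 6) (best A (x + y)) := by
  simp only [Finset.mem_insert, Finset.mem_singleton, not_or] at hu hw
  obtain ⟨hu7, hu8, hu10⟩ := hu
  obtain ⟨hw7, hw8, hw10⟩ := hw
  refine Run.mono (Q := fun m => Rep (m 5) (reach A (x + y)) ∧ Rep (m 6) (best A (x + y)))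
    (k := matCost n 1 + (matCost n (forCost n 2) + (matCost n 1 +
    (matCost n (forCost n 2) + (matCost n (forCost n 2) + (matCost n 1 + matCost n 1))))))
    ?_ subset_rfl subset_rfl (by unfold pairCost; omega) fun _ _ h => h
  refine Run.seq ((run_zeroMat hn 7).mono (by decide) (by decide) le_rfl (Q' := fun m =>
    Rep (m 7) (0 : Matrix (Fin n) (Fin n) ℝ≥0) ∧ ∀ a, a ≠ 7 → m a = s.real a)
    fun s' hf h => ⟨h, fun a ha => hf.2 a (by simpa using ha)⟩) fun s₁ hf₁ h₁ => ?_
  have hn₁ : s₁.reg 0 = n := (hf₁.1 0 (by decide)).trans hn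
  refine Run.seq ((run_mulAcc hn₁ (by decide) hu7 (by decide) hu10 (by decide) h₁.1
    (M := reach A x) (M' := reach A y) (by rwa [h₁.2 5 (by decide)])
    (by rwa [h₁.2 u hu7])).mono (by decide) (by decide) le_rfl
    (Q' := fun m => Rep (m 7) (reach A (x + y)) ∧ ∀ a, a ≠ 7 → a ≠ 10 → m a = s.real a)
    fun s' hf h => ⟨fun i j => ?_, fun a h7 h10 => ?_⟩) fun s₂ hf₂ h₂ => ?_
  · rw [h i j, reach_add]
    simp
  · rw [hf.2 a (by simp [h7, h10]), h₁.2 a h7]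
  have hn₂ : s₂.reg 0 = n := (hf₂.1 0 (by decide)).trans hn₁
  refine Run.seq ((run_zeroMat hn₂ 8).mono (by decide) (by decide) le_rfl (Q' := fun m =>
    Rep (m 8) (0 : Matrix (Fin n) (Fin n) ℝ≥0) ∧ Rep (m 7) (reach A (x + y)) ∧
      ∀ a, a ≠ 7 → a ≠ 8 → a ≠ 10 → m a = s.real a)
    fun s' hf h => ⟨h, ?_, fun a h7 h8 h10 => ?_⟩) fun s₃ hf₃ h₃ => ?_
  · rw [hf.2 7 (by decide)]; exact h₂.1
  · rw [hf.2 a (by simpa using h8), h₂.2 a h7 h10]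
  have hn₃ : s₃.reg 0 = n := (hf₃.1 0 (by decide)).trans hn₂
  refine Run.seq ((run_mulAcc hn₃ (by decide) hu8 (by decide) hu10 (by decide) h₃.1
    (M := best A x) (M' := reach A y) (by rwa [h₃.2.2 6 (by decide) (by decide) (by decide)])
    (by rwa [h₃.2.2 u hu7 hu8 hu10])).mono (by decide) (by decide) le_rfl
    (Q' := fun m => Rep (m 8) (mul (best A x) (reach A y)) ∧ Rep (m 7) (reach A (x + y)) ∧
      ∀ a, a ≠ 7 → a ≠ 8 → a ≠ 10 → m a = s.real a)
    fun s' hf h => ⟨fun i j => ?_, ?_, fun a h7 h8 h10 => ?_⟩) fun s₄ hf₄ h₄ => ?_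
  · rw [h i j]
    simp
  · rw [hf.2 7 (by decide)]; exact h₃.2.1
  · rw [hf.2 a (by simp [h8, h10]), h₃.2.2 a h7 h8 h10]
  have hn₄ : s₄.reg 0 = n := (hf₄.1 0 (by decide)).trans hn₃
  refine Run.seq ((run_mulAcc hn₄ (by decide) hw8 (by decide) hw10 (by decide) h₄.1
    (M := reach A x) (M' := best A y) (by rwa [h₄.2.2 5 (by decide) (by decide) (by decide)])
    (by rwa [h₄.2.2 w hw7 hw8 hw10])).mono (by decide) (by decide) le_rfl
    (Q' := fun m => Rep (m 8) (best A (x + y)) ∧ Rep (m 7) (reach A (x + y)))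
    fun s' hf h => ⟨fun i j => ?_, ?_⟩) fun s₅ hf₅ h₅ => ?_
  · rw [h i j, best_add]
  · rw [hf.2 7 (by decide)]; exact h₄.2.1
  have hn₅ : s₅.reg 0 = n := (hf₅.1 0 (by decide)).trans hn₄
  refine Run.seq ((run_copyMat hn₅ (by decide) h₅.2).mono (by decide) (by decide) le_rfl
    (Q' := fun m => Rep (m 8) (best A (x + y)) ∧ Rep (m 5) (reach A (x + y)))
    fun s' hf h => ⟨?_, h⟩) fun s₆ hf₆ h₆ => ?_
  · rw [hf.2 8 (by decide)]; exact h₅.1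
  have hn₆ : s₆.reg 0 = n := (hf₆.1 0 (by decide)).trans hn₅
  refine (run_copyMat hn₆ (by decide) h₆.1).mono (by decide) (by decide) le_rfl
    fun s' hf h => ⟨?_, h⟩
  rw [hf.2 5 (by decide)]; exact h₆.2

end Routines

/-! ### Computation of the cycle means and of the matrices of the criterion -/

section Phases

variable {n : ℕ} {s : Store} {A : Matrix (Fin n) (Fin n) ℝ≥0}

/-- With `k` in the index register `4` and `i` in the index register `1`, compute the power of the
entry `i, i` of the array `1` whose exponent is the product of the numbers `1, …, n` other than
`k + 1`. -/
def Prog.scalarPow : Prog :=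
  .seq (.op (.realCopy ⟨12, 9, 9⟩ ⟨1, 1, 1⟩))
    (.forLoop 5 0 (.ite (.eq 5 4) (.op (.realCopy ⟨12, 9, 9⟩ ⟨12, 9, 9⟩))
      (.seq (.op (.realCopy ⟨13, 9, 9⟩ ⟨12, 9, 9⟩))
        (.forLoop 6 5 (.op (.realMul ⟨12, 9, 9⟩ ⟨12, 9, 9⟩ ⟨13, 9, 9⟩))))))

/-- Raising to the powers 1, …, n one after another, with k + 1 left out, takes O(n²)
multiplications. Over all pairs of an exponent and a diagonal entry this stays within O(n⁴). -/
theorem run_scalarPow {k i : ℕ} {x : ℝ≥0} (hn : s.reg 0 = n) (hz : s.reg 9 = 0)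
    (hk : s.reg 4 = k) (hi : s.reg 1 = i) (hx : s.real 1 i i = x) :
    Run {5, 6} {12, 13} .scalarPow (1 + forCost n (1 + (1 + forCost n 1))) s
      fun m => m 12 0 0 = x ^ ∏ l ∈ (Finset.range n).erase k, (l + 1) := by
  refine Run.seq (Run.realOp _ ⟨12, 9, 9⟩ x ?_ (by simp) (Q := fun m => m 12 0 0 = x) ?_)
    fun s₁ hf₁ h₁ => ?_
  · simp [Instr.apply, Store.getReal, hi, hx]
  · simp [setReal_real, hz]
  have hz₁ : s₁.reg 9 = 0 := (hf₁.1 9 (by decide)).trans hz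
  refine Run.forLoop (R := {6}) ((hf₁.1 0 (by decide)).trans hn) (by decide) (by decide)
    (fun y m => m 12 0 0 = x ^ ∏ l ∈ (Finset.range y).erase k, (l + 1)) (by simpa using h₁) ?_
  intro y hy s₂ hf₂ h5 hI
  have hz₂ : s₂.reg 9 = 0 := (hf₂.1 9 (by decide)).trans hz₁
  have hk₂ : s₂.reg 4 = k := (hf₂.1 4 (by decide)).trans ((hf₁.1 4 (by decide)).trans hk)
  refine Run.ite (fun hb => ?_) fun hb => ?_
  · have hyk : y = k := by
      have h : s₂.reg 5 = s₂.reg 4 := hb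
      rwa [h5, hk₂] at h
    refine (Run.realOp _ ⟨12, 9, 9⟩ _ rfl (by simp) ?_).weaken subset_rfl subset_rfl
      (by omega)
    rw [setReal_real, if_pos ⟨rfl, hz₂.symm, hz₂.symm⟩, Store.getReal, hz₂, hI, hyk]
    congr 2
    ext l
    simp
    omega
  · have hyk : y ≠ k := fun h => hb (by rw [Test.Holds, h5, hk₂, h])
    set q := x ^ ∏ l ∈ (Finset.range y).erase k, (l + 1) with hq
    refine Run.seq (Run.realOp _ ⟨13, 9, 9⟩ q ?_ (by simp)
      (Q := fun m => m 12 0 0 = q ∧ m 13 0 0 = q) ?_) fun s₃ hf₃ h₃ => ?_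
    · simp only [Instr.apply, Store.getReal, hz₂, hI]
    · simpa [setReal_real, hz₂] using hI
    have hz₃ : s₃.reg 9 = 0 := (hf₃.1 9 (by decide)).trans hz₂
    -- The loop is bounded by the outer counter y: starting from q, y multiplications by the saved q
    -- give q^(y + 1).
    refine (Run.forLoop (R := ∅) (k := 1) ((hf₃.1 5 (by decide)).trans h5) (by decide) (by decide)
      (fun z m => m 12 0 0 = q ^ (z + 1) ∧ m 13 0 0 = q) (by simpa using h₃) ?_).mono subset_rfl
      subset_rfl (forCost_mono hy.le le_rfl) ?_
    · rintro z - s₄ hf₄ - ⟨h12, h13⟩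
      have hz₄ : s₄.reg 9 = 0 := (hf₄.1 9 (by decide)).trans hz₃
      refine Run.realOp _ ⟨12, 9, 9⟩ (q ^ (z + 1 + 1)) ?_ (by simp) ⟨?_, ?_⟩
      · simp only [Instr.apply, Store.getReal, hz₄, h12, h13, pow_succ]
      · simp [setReal_real, hz₄]
      · simpa [setReal_real] using h13
    · rintro s₄ - ⟨h12, -⟩
      rw [h12, hq, ← pow_mul, Finset.range_add_one, Finset.erase_insert_of_ne hyk,
        Finset.prod_insert (by simp), mul_comm]

/-- Compute `lamHat` into the first column of the array `4`. -/
def Prog.lamPhase : Prog :=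
  .seq (.matLoop (.ite (.eq 1 2) (.op (.realOne ⟨1, 1, 2⟩)) (.op (.realZero ⟨1, 1, 2⟩))))
    (.forLoop 4 0 (.seq (.zeroMat 2) <| .seq (.mulAcc 2 1 0) <| .seq (.copyMat 1 2) <|
      .forLoop 1 0 (.seq .scalarPow (.op (.realMax ⟨4, 1, 9⟩ ⟨4, 1, 9⟩ ⟨12, 9, 9⟩)))))

/-- Number of operations of `Prog.lamPhase`. -/
def lamCost (n : ℕ) : ℕ :=
  matCost n (1 + 1) + forCost n (matCost n 1 + (matCost n (forCost n 2) + (matCost n 1 +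
    forCost n (1 + forCost n (1 + (1 + forCost n 1)) + 1))))

theorem run_lamPhase (hn : s.reg 0 = n) (hz : s.reg 9 = 0) (hA : Rep (s.real 0) A)
    (h4 : ∀ x y, s.real 4 x y = 0) :
    Run {1, 2, 3, 4, 5, 6} {1, 2, 4, 10, 12, 13} .lamPhase (lamCost n) s
      fun m => ∀ i : Fin n, m 4 i 0 = lamHat A i := by
  refine Run.seq (Run.mono (R := {1, 2}) (D := {1}) (Q := fun m => Rep (m 1) (pow A 0))
    (Run.matLoop (R := ∅) hn (by simp) (by simp) (by simp) _
    fun i j s' hf h1 h2 _ => ?_) (by decide) (by decide) le_rfl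
    (Q' := fun m => Rep (m 1) (pow A 0) ∧ m 4 = s.real 4)
    fun s' hf h => ⟨h, hf.2 4 (by decide)⟩) fun s₁ hf₁ h₁ => ?_
  · refine Run.ite (fun hb => ?_) fun hb => ?_
    · have hij : i = j := Fin.ext (h1.symm.trans (Eq.trans hb h2))
      refine Run.realOp _ ⟨1, 1, 2⟩ _ rfl (by simp) ?_
      rw [show pow A 0 i j = 1 by rw [hij]; exact Matrix.one_apply_eq j]
      exact setReal_entry h1 h2 1
    · have hij : i ≠ j := fun h => hb (h1.trans ((congrArg Fin.val h).trans h2.symm))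
      refine Run.realOp _ ⟨1, 1, 2⟩ _ rfl (by simp) ?_
      rw [show pow A 0 i j = 0 from Matrix.one_apply_ne hij]
      exact setReal_entry h1 h2 0
  have hn₁ : s₁.reg 0 = n := (hf₁.1 0 (by decide)).trans hn
  have hz₁ : s₁.reg 9 = 0 := (hf₁.1 9 (by decide)).trans hz
  have hA₁ : Rep (s₁.real 0) A := by rwa [hf₁.2 0 (by decide)]
  refine (Run.forLoop (R := {1, 2, 3, 5, 6}) (D := {1, 2, 4, 10, 12, 13}) hn₁ (by decide) (by decide)
    (fun k m => Rep (m 1) (pow A k) ∧ ∀ i : Fin n, m 4 i 0 = (Finset.range k).sup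
      fun k => pow A (k + 1) i i ^ ∏ m ∈ (Finset.range n).erase k, (m + 1))
    ⟨h₁.1, fun i => by simp [h₁.2, h4]⟩ ?_).mono (by decide) (by decide) le_rfl fun _ _ h => h.2
  rintro k hk s₂ hf₂ hk₂ ⟨hP, hL⟩
  have hn₂ : s₂.reg 0 = n := (hf₂.1 0 (by decide)).trans hn₁
  have hz₂ : s₂.reg 9 = 0 := (hf₂.1 9 (by decide)).trans hz₁
  have hA₂ : Rep (s₂.real 0) A := by rwa [hf₂.2 0 (by decide)]
  refine Run.seq ((run_zeroMat hn₂ 2).mono (by decide) (by decide) le_rfl (Q' := fun m =>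
    Rep (m 2) (0 : Matrix (Fin n) (Fin n) ℝ≥0) ∧ m 1 = s₂.real 1 ∧ m 4 = s₂.real 4)
    fun s' hf h => ⟨h, hf.2 1 (by decide), hf.2 4 (by decide)⟩) fun s₃ hf₃ h₃ => ?_
  have hn₃ : s₃.reg 0 = n := (hf₃.1 0 (by decide)).trans hn₂
  refine Run.seq ((run_mulAcc hn₃ (by decide) (by decide) (by decide) (by decide) (by decide) h₃.1
    (M := pow A k) (M' := A) (by rwa [h₃.2.1]) (by rwa [hf₃.2 0 (by decide)])).mono (by decide)
    (by decide) le_rfl (Q' := fun m => Rep (m 2) (pow A (k + 1)) ∧ m 4 = s₂.real 4)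
    fun s' hf h => ⟨fun i j => ?_, ?_⟩) fun s₄ hf₄ h₄ => ?_
  · rw [h i j]
    simp [pow]
  · rw [hf.2 4 (by decide), h₃.2.2]
  have hn₄ : s₄.reg 0 = n := (hf₄.1 0 (by decide)).trans hn₃
  refine Run.seq ((run_copyMat hn₄ (by decide) h₄.1).mono (by decide) (by decide) le_rfl
    (Q' := fun m => Rep (m 1) (pow A (k + 1)) ∧ m 4 = s₂.real 4)
    fun s' hf h => ⟨h, ?_⟩) fun s₅ hf₅ h₅ => ?_
  · rw [hf.2 4 (by decide), h₄.2]
  have hn₅ : s₅.reg 0 = n := (hf₅.1 0 (by decide)).trans hn₄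
  have hf₂₅ := hf₃.trans (hf₄.trans hf₅)
  have hz₅ : s₅.reg 9 = 0 := (hf₂₅.1 9 (by decide)).trans hz₂
  have hk₅ : s₅.reg 4 = k := (hf₂₅.1 4 (by decide)).trans hk₂
  let E : ℕ → ℕ := fun k => ∏ m ∈ (Finset.range n).erase k, (m + 1)
  let L : ℕ → Fin n → ℝ≥0 := fun k i => (Finset.range k).sup fun k => pow A (k + 1) i i ^ E k
  refine (Run.forLoop (R := {5, 6}) (D := {4, 12, 13}) hn₅ (by decide) (by decide)
    (fun x m => ∀ i : Fin n, m 4 i 0 = if (i : ℕ) < x then L (k + 1) i else L k i)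
    (fun i => by rw [h₅.2, hL]; simp [L, E]) ?_).mono (by decide) (by decide) le_rfl ?_
  · intro x hx s₆ hf₆ hx₆ hI
    have hn₆ : s₆.reg 0 = n := (hf₆.1 0 (by decide)).trans hn₅
    have hz₆ : s₆.reg 9 = 0 := (hf₆.1 9 (by decide)).trans hz₅
    have hk₆ : s₆.reg 4 = k := (hf₆.1 4 (by decide)).trans hk₅
    refine Run.seq ((run_scalarPow (x := pow A (k + 1) ⟨x, hx⟩ ⟨x, hx⟩) hn₆ hz₆ hk₆ hx₆
      (by rw [hf₆.2 1 (by decide)]; exact h₅.1 ⟨x, hx⟩ ⟨x, hx⟩)).mono (by decide) (by decide)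
      le_rfl (Q' := fun m => m 12 0 0 = pow A (k + 1) ⟨x, hx⟩ ⟨x, hx⟩ ^ E k ∧ m 4 = s₆.real 4)
      fun s' hf h => ⟨h, hf.2 4 (by decide)⟩) fun s₇ hf₇ h₇ => ?_
    have hz₇ : s₇.reg 9 = 0 := (hf₇.1 9 (by decide)).trans hz₆
    have hx₇ : s₇.reg 1 = x := (hf₇.1 1 (by decide)).trans hx₆
    refine Run.realOp _ ⟨4, 1, 9⟩ (L (k + 1) ⟨x, hx⟩) ?_ (by simp) ?_
    · simp only [Instr.apply, Store.getReal, hz₇, hx₇, h₇.1, h₇.2]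
      rw [hI ⟨x, hx⟩, if_neg (by simp)]
      simp only [L, Finset.range_add_one, Finset.sup_insert]
      rw [max_comm]
    · intro i
      simp only [setReal_real, hz₇, hx₇, h₇.2]
      by_cases hi : (i : ℕ) = x
      · rw [if_pos ⟨trivial, hi, trivial⟩, if_pos (by omega)]
        congr
        exact hi.symm
      · rw [if_neg (by tauto), hI i]
        exact if_congr (by omega) rfl rfl
  · intro s' hf hI
    refine ⟨by rw [hf.2 1 (by decide)]; exact h₅.1, fun i => ?_⟩
    rw [hI i, if_pos i.2]

/-- Compute the matrices of the walks of length `1` into the arrays `16` and `17`, and copy them to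
the arrays `5` and `6`. -/
def Prog.initPhase : Prog :=
  .seq (.matLoop (.ite (.realLe ⟨0, 1, 2⟩ ⟨11, 9, 9⟩) (.op (.realZero ⟨16, 1, 2⟩))
    (.op (.realOne ⟨16, 1, 2⟩)))) <|
  .seq (.matLoop (.seq (.op (.realMul ⟨10, 9, 9⟩ ⟨4, 1, 9⟩ ⟨16, 1, 2⟩)) <|
    .seq (.op (.realMul ⟨13, 9, 9⟩ ⟨4, 2, 9⟩ ⟨16, 1, 2⟩))
      (.op (.realMax ⟨17, 1, 2⟩ ⟨10, 9, 9⟩ ⟨13, 9, 9⟩)))) <|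
  .seq (.copyMat 5 16) (.copyMat 6 17)

/-- Number of operations of `Prog.initPhase`. -/
def initCost (n : ℕ) : ℕ :=
  matCost n (1 + 1) + (matCost n (1 + (1 + 1)) + (matCost n 1 + matCost n 1))

theorem run_initPhase (hn : s.reg 0 = n) (hz : s.reg 9 = 0) (hA : Rep (s.real 0) A)
    (h4 : ∀ i : Fin n, s.real 4 i 0 = lamHat A i) (h11 : ∀ x y, s.real 11 x y = 0) :
    Run {1, 2} {5, 6, 10, 13, 16, 17} .initPhase (initCost n) s
      fun m => (Rep (m 16) (reach A 1) ∧ Rep (m 17) (best A 1)) ∧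
        Rep (m 5) (reach A 1) ∧ Rep (m 6) (best A 1) := by
  refine Run.seq (Run.weaken (R := {1, 2}) (D := {16}) (Q := fun m => Rep (m 16) (reach A 1))
    (Run.matLoop (R := ∅) hn (by simp) (by simp) (by simp) _
    fun i j s' hf h1 h2 _ => ?_) (by decide) (by decide) le_rfl)
    fun s₁ hf₁ h₁ => ?_
  · have hle : Test.Holds (.realLe ⟨0, 1, 2⟩ ⟨11, 9, 9⟩) s' ↔ A i j ≤ 0 := by
      simp only [Test.Holds, Store.getReal, h1, h2]
      rw [hf.2 0 (by decide), hf.2 11 (by decide), h11, hA]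
    refine Run.ite (fun hb => ?_) fun hb => ?_
    · refine Run.realOp _ ⟨16, 1, 2⟩ _ rfl (by simp) ?_
      rw [reach_one, if_pos (hle.1 hb)]
      exact setReal_entry h1 h2 0
    · refine Run.realOp _ ⟨16, 1, 2⟩ _ rfl (by simp) ?_
      rw [reach_one, if_neg (fun h => hb (hle.2 h))]
      exact setReal_entry h1 h2 1
  have hn₁ : s₁.reg 0 = n := (hf₁.1 0 (by decide)).trans hn
  have hz₁ : s₁.reg 9 = 0 := (hf₁.1 9 (by decide)).trans hz
  have h4₁ : ∀ i : Fin n, s₁.real 4 i 0 = lamHat A i := fun i => by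
    rw [hf₁.2 4 (by decide), h4]
  refine Run.seq (Run.mono (R := {1, 2}) (D := {10, 13, 17}) (Q := fun m => Rep (m 17) (best A 1))
    (Run.matLoop (R := ∅) hn₁ (by simp) (by simp) (by simp) _
    fun i j s' hf h1 h2 _ => ?_) (by decide) (by decide) le_rfl
    (Q' := fun m => Rep (m 16) (reach A 1) ∧ Rep (m 17) (best A 1))
    fun s' hf h => ⟨?_, h⟩) fun s₂ hf₂ h₂ => ?_
  · have hz' : s'.reg 9 = 0 := (hf.1 9 (by decide)).trans hz₁
    have hB : s'.real 16 i j = reach A 1 i j := by rw [hf.2 16 (by decide), h₁]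
    have hL : ∀ i : Fin n, s'.real 4 i 0 = lamHat A i := fun i => by
      rw [hf.2 4 (by decide), h4₁]
    refine Run.seq (Run.realOp _ ⟨10, 9, 9⟩ (lamHat A i * reach A 1 i j) ?_ (by simp) (Q := fun m =>
      m 10 0 0 = lamHat A i * reach A 1 i j ∧ ∀ a, a ≠ 10 → m a = s'.real a) ⟨?_, ?_⟩)
      fun s₂ hf₂ h₂ => ?_
    · simp only [Instr.apply, Store.getReal, h1, h2, hz', hB, hL]
    · simp [setReal_real, hz']
    · intro a ha
      funext x y
      simp [setReal_real, ha]
    have hz₂ : s₂.reg 9 = 0 := (hf₂.1 9 (by decide)).trans hz'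
    have h1' : s₂.reg 1 = i := (hf₂.1 1 (by decide)).trans h1
    have h2' : s₂.reg 2 = j := (hf₂.1 2 (by decide)).trans h2
    refine Run.seq (Run.realOp _ ⟨13, 9, 9⟩ (lamHat A j * reach A 1 i j) ?_ (by simp) (Q := fun m =>
      m 10 0 0 = lamHat A i * reach A 1 i j ∧ m 13 0 0 = lamHat A j * reach A 1 i j ∧
        m 17 = s'.real 17) ⟨?_, ?_, ?_⟩) fun s₃ hf₃ h₃ => ?_
    · simp only [Instr.apply, Store.getReal, h1', h2', hz₂]
      rw [h₂.2 4 (by decide), h₂.2 16 (by decide), hB, hL]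
    · simpa [setReal_real] using h₂.1
    · simp [setReal_real, hz₂]
    · rw [← h₂.2 17 (by decide)]
      funext x y
      simp [setReal_real]
    have hz₃ : s₃.reg 9 = 0 := (hf₃.1 9 (by decide)).trans hz₂
    have h1'' : s₃.reg 1 = i := (hf₃.1 1 (by decide)).trans h1'
    have h2'' : s₃.reg 2 = j := (hf₃.1 2 (by decide)).trans h2'
    refine Run.realOp _ ⟨17, 1, 2⟩ (best A 1 i j) ?_ (by simp) ?_
    · simp only [Instr.apply, Store.getReal, hz₃, h₃.1, h₃.2.1, ← best_one]
    · rw [← h₃.2.2]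
      exact setReal_entry h1'' h2'' _
  · rw [hf.2 16 (by decide)]; exact h₁
  have hn₂ : s₂.reg 0 = n := (hf₂.1 0 (by decide)).trans hn₁
  refine Run.seq ((run_copyMat hn₂ (by decide) h₂.1).mono (by decide) (by decide) le_rfl
    (Q' := fun m => (Rep (m 16) (reach A 1) ∧ Rep (m 17) (best A 1)) ∧ Rep (m 5) (reach A 1))
    fun s' hf h => ⟨?_, h⟩) fun s₃ hf₃ h₃ => ?_
  · rw [hf.2 16 (by decide), hf.2 17 (by decide)]; exact h₂
  have hn₃ : s₃.reg 0 = n := (hf₃.1 0 (by decide)).trans hn₂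
  refine (run_copyMat hn₃ (by decide) h₃.1.2).mono (by decide) (by decide) le_rfl
    fun s' hf h => ⟨?_, ?_, h⟩
  · rw [hf.2 16 (by decide), hf.2 17 (by decide)]; exact h₃.1
  · rw [hf.2 5 (by decide)]; exact h₃.2

/-- Compute the matrices of the walks of length `8 ^ n` by repeated squaring. -/
def Prog.squarePhase : Prog :=
  .forLoop 4 0 (.seq (.pairMul 5 6) (.seq (.pairMul 5 6) (.pairMul 5 6)))

/-- Number of operations of `Prog.squarePhase`. -/
def squareCost (n : ℕ) : ℕ := forCost n (pairCost n + (pairCost n + pairCost n))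

theorem run_squarePhase (hn : s.reg 0 = n) (h5 : Rep (s.real 5) (reach A 1))
    (h6 : Rep (s.real 6) (best A 1)) :
    Run {1, 2, 3, 4} {5, 6, 7, 8, 10} .squarePhase (squareCost n) s
      fun m => Rep (m 5) (reach A (8 ^ n)) ∧ Rep (m 6) (best A (8 ^ n)) := by
  refine (Run.forLoop (R := {1, 2, 3}) (D := {5, 6, 7, 8, 10}) hn (by decide) (by decide)
    (fun k m => Rep (m 5) (reach A (8 ^ k)) ∧ Rep (m 6) (best A (8 ^ k))) ⟨h5, h6⟩ ?_).weaken
    (by decide) (by decide) le_rfl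
  rintro k - s₁ hf₁ - ⟨h5₁, h6₁⟩
  have hn₁ : s₁.reg 0 = n := (hf₁.1 0 (by decide)).trans hn
  refine Run.seq (run_pairMul hn₁ (by decide) (by decide) h5₁ h6₁ h5₁ h6₁) fun s₂ hf₂ h₂ => ?_
  have hn₂ : s₂.reg 0 = n := (hf₂.1 0 (by decide)).trans hn₁
  refine Run.seq (run_pairMul hn₂ (by decide) (by decide) h₂.1 h₂.2 h₂.1 h₂.2) fun s₃ hf₃ h₃ => ?_
  have hn₃ : s₃.reg 0 = n := (hf₃.1 0 (by decide)).trans hn₂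
  have := run_pairMul hn₃ (by decide) (by decide) h₃.1 h₃.2 h₃.1 h₃.2
  -- Three doublings per round multiply the length by 8, and n rounds make it at least 2n² with n
  -- itself as loop bound.
  rw [show 8 ^ (k + 1) = 8 ^ k + 8 ^ k + (8 ^ k + 8 ^ k) + (8 ^ k + 8 ^ k + (8 ^ k + 8 ^ k)) by
    ring]
  exact this

end Phases

/-! ### The check and the complete program -/

section Check

variable {n : ℕ} {s : Store} {A : Matrix (Fin n) (Fin n) ℝ≥0}

/-- State of the check after the comparison of the values `val t i j k` with `(t, i, j, k)` in `Z`: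
the array `15` holds nonzero values seen for the pairs of columns, and the cell of the array `14` is
zero if different nonzero values have been seen for a pair of columns. -/
structure Agrees (val : ℕ → Fin n → Fin n → Fin n → ℝ≥0) (Z : Set (ℕ × Fin n × Fin n × Fin n))
    (m : ℕ → ℕ → ℕ → ℝ≥0) : Prop where
  eq_zero : ∀ t i (j k : Fin n), m 15 j k = 0 → (t, i, j, k) ∈ Z → val t i j k = 0
  exists_eq : ∀ j k : Fin n, m 15 j k ≠ 0 → ∃ t i, (t, i, j, k) ∈ Z ∧ val t i j k = m 15 j k
  flag : m 14 0 0 ≠ 0 ↔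
    ∀ t i (j k : Fin n), (t, i, j, k) ∈ Z → val t i j k ≠ 0 → val t i j k = m 15 j k

variable {val : ℕ → Fin n → Fin n → Fin n → ℝ≥0} {Z : Set (ℕ × Fin n × Fin n × Fin n)}
  {m m' : ℕ → ℕ → ℕ → ℝ≥0} {t : ℕ} {i j k : Fin n}

theorem Agrees.congr (h : Agrees val Z m) (h14 : m' 14 = m 14) (h15 : m' 15 = m 15) :
    Agrees val Z m' := by
  constructor
  · rw [h15]; exact h.eq_zero
  · rw [h15]; exact h.exists_eq
  · rw [h14, h15]; exact h.flag

theorem Agrees.insert_of_zero (h : Agrees val Z m) (h0 : val t i j k = 0) :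
    Agrees val (insert (t, i, j, k) Z) m := by
  constructor
  · rintro t' i' j' k' hm (he | hZ)
    · cases he; exact h0
    · exact h.eq_zero t' i' j' k' hm hZ
  · intro j' k' hm
    obtain ⟨t', i', hZ, he⟩ := h.exists_eq j' k' hm
    exact ⟨t', i', Or.inr hZ, he⟩
  · rw [h.flag]
    refine ⟨?_, fun h' t' i' j' k' hZ => h' t' i' j' k' (Or.inr hZ)⟩
    rintro h' t' i' j' k' (he | hZ) hne
    · cases he; exact absurd h0 hne
    · exact h' t' i' j' k' hZ hne

theorem Agrees.insert_of_eq (h : Agrees val Z m) (h0 : val t i j k = m 15 j k) :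
    Agrees val (insert (t, i, j, k) Z) m := by
  constructor
  · rintro t' i' j' k' hm (he | hZ)
    · cases he; exact h0.trans hm
    · exact h.eq_zero t' i' j' k' hm hZ
  · intro j' k' hm
    obtain ⟨t', i', hZ, he⟩ := h.exists_eq j' k' hm
    exact ⟨t', i', Or.inr hZ, he⟩
  · rw [h.flag]
    refine ⟨?_, fun h' t' i' j' k' hZ => h' t' i' j' k' (Or.inr hZ)⟩
    rintro h' t' i' j' k' (he | hZ) hne
    · cases he; exact h0
    · exact h' t' i' j' k' hZ hne

theorem Agrees.insert_of_ne (h : Agrees val Z m) (hm0 : m 15 j k ≠ 0) (h0 : val t i j k ≠ 0)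
    (hne : val t i j k ≠ m 15 j k) (h14 : m' 14 0 0 = 0) (h15 : m' 15 = m 15) :
    Agrees val (insert (t, i, j, k) Z) m' := by
  constructor
  · rw [h15]
    rintro t' i' j' k' hm (he | hZ)
    · cases he; exact absurd hm hm0
    · exact h.eq_zero t' i' j' k' hm hZ
  · rw [h15]
    intro j' k' hm
    obtain ⟨t', i', hZ, he⟩ := h.exists_eq j' k' hm
    exact ⟨t', i', Or.inr hZ, he⟩
  · rw [h14, h15]
    exact ⟨fun h' => absurd rfl h', fun h' => absurd (h' t i j k (Or.inl rfl) h0) hne⟩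

/-- Filling an empty cell cannot affect the flag: a zero cell means that all earlier values for this
pair of columns were zero. -/
theorem Agrees.insert_of_new (h : Agrees val Z m) (hm0 : m 15 j k = 0) (h0 : val t i j k ≠ 0)
    (h14 : m' 14 0 0 = m 14 0 0) (h15 : m' 15 j k = val t i j k)
    (h15' : ∀ x y, ¬ (x = (j : ℕ) ∧ y = (k : ℕ)) → m' 15 x y = m 15 x y) :
    Agrees val (insert (t, i, j, k) Z) m' := by
  have hcase : ∀ j' k' : Fin n, (j' = j ∧ k' = k) ∨ m' 15 j' k' = m 15 j' k' := by
    intro j' k'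
    by_cases hjk : j' = j ∧ k' = k
    · exact Or.inl hjk
    · exact Or.inr (h15' j' k' fun h => hjk ⟨Fin.ext h.1, Fin.ext h.2⟩)
  constructor
  · rintro t' i' j' k' hm hZ
    rcases hcase j' k' with ⟨rfl, rfl⟩ | he
    · exact absurd (h15.symm.trans hm) h0
    · rcases hZ with hp | hZ
      · cases hp; exact absurd (h15.symm.trans hm) h0
      · exact h.eq_zero t' i' j' k' (he ▸ hm) hZ
  · intro j' k' hm
    rcases hcase j' k' with ⟨rfl, rfl⟩ | he
    · exact ⟨t, i, Or.inl rfl, h15.symm⟩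
    · obtain ⟨t', i', hZ, he'⟩ := h.exists_eq j' k' (he ▸ hm)
      exact ⟨t', i', Or.inr hZ, he'.trans he.symm⟩
  · rw [h14, h.flag]
    constructor
    · rintro h' t' i' j' k' (hp | hZ) hne
      · cases hp; exact h15.symm
      · rcases hcase j' k' with ⟨rfl, rfl⟩ | he
        · exact absurd (h.eq_zero _ _ _ _ hm0 hZ) hne
        · exact (h' t' i' j' k' hZ hne).trans he.symm
    · intro h' t' i' j' k' hZ hne
      rcases hcase j' k' with ⟨rfl, rfl⟩ | he
      · exact absurd (h.eq_zero _ _ _ _ hm0 hZ) hne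
      · exact (h' t' i' j' k' (Or.inr hZ) hne).trans he

/-- A nonzero recorded value is one of the values seen, so comparing everything with it amounts to
comparing all pairs, at linear instead of quadratic cost. -/
theorem Agrees.flag_iff (h : Agrees val Z m) : m 14 0 0 ≠ 0 ↔
    ∀ j k i i' t t', (t, i, j, k) ∈ Z → (t', i', j, k) ∈ Z → val t i j k ≠ 0 →
      val t' i' j k ≠ 0 → val t i j k = val t' i' j k := by
  rw [h.flag]
  constructor
  · intro h' j k i i' t t' hZ hZ' h0 h0'
    rw [h' t i j k hZ h0, h' t' i' j k hZ' h0']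
  · intro h' t i j k hZ h0
    obtain ⟨t', i', hZ', he⟩ := h.exists_eq j k fun hm => h0 (h.eq_zero t i j k hm hZ)
    rw [← he]
    refine h' j k i i' t t' hZ hZ' h0 fun h0' => h0 (h.eq_zero t i j k ?_ hZ)
    rw [← he, h0']

/-- Do nothing. -/
def Prog.skip : Prog := .op (.realCopy ⟨10, 9, 9⟩ ⟨10, 9, 9⟩)

theorem run_skip {R D : Finset ℕ} {Q : (ℕ → ℕ → ℕ → ℝ≥0) → Prop} (hD : 10 ∈ D) (h : Q s.real) :
    Run R D .skip 1 s Q := by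
  refine Run.realOp _ ⟨10, 9, 9⟩ (s.real 10 (s.reg 9) (s.reg 9)) rfl hD ?_
  convert h using 1
  funext a x y
  rw [setReal_real]
  split_ifs with h
  · rw [h.1, h.2.1, h.2.2]
  · rfl

/-- With `i`, `j` and `k` in the index registers `1`, `2` and `3`, check the maximum of the entries
`i, j` and `i, k` of the array `6`. -/
def Prog.checkEntry : Prog :=
  .seq (.op (.realMax ⟨10, 9, 9⟩ ⟨6, 1, 2⟩ ⟨6, 1, 3⟩)) <|
    .ite (.realLe ⟨10, 9, 9⟩ ⟨11, 9, 9⟩) .skip <|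
    .ite (.realLe ⟨15, 2, 3⟩ ⟨11, 9, 9⟩) (.op (.realCopy ⟨15, 2, 3⟩ ⟨10, 9, 9⟩)) <|
    .ite (.realLe ⟨10, 9, 9⟩ ⟨15, 2, 3⟩)
      (.ite (.realLe ⟨15, 2, 3⟩ ⟨10, 9, 9⟩) .skip (.op (.realZero ⟨14, 9, 9⟩)))
      (.op (.realZero ⟨14, 9, 9⟩))

theorem run_checkEntry (hz : s.reg 9 = 0) (h1 : s.reg 1 = i) (h2 : s.reg 2 = j)
    (h3 : s.reg 3 = k) (h11 : ∀ x y, s.real 11 x y = 0)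
    (hval : max (s.real 6 i j) (s.real 6 i k) = val t i j k) (h : Agrees val Z s.real) :
    Run ∅ {10, 14, 15} .checkEntry 6 s (Agrees val (insert (t, i, j, k) Z)) := by
  refine Run.seq (k := 1) (k' := 5) (Run.realOp _ ⟨10, 9, 9⟩ (val t i j k) ?_ (by simp)
    (Q := fun m => m 10 0 0 = val t i j k ∧ ∀ a, a ≠ 10 → m a = s.real a) ⟨?_, ?_⟩)
    fun s₁ hf₁ h₁ => ?_
  · simp only [Instr.apply, Store.getReal, h1, h2, h3, hval]
  · simp [setReal_real, hz]
  · intro a ha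
    funext x y
    simp [setReal_real, ha]
  obtain ⟨h10, hrest⟩ := h₁
  have hz₁ : s₁.reg 9 = 0 := (hf₁.1 9 (by decide)).trans hz
  have h2₁ : s₁.reg 2 = j := (hf₁.1 2 (by decide)).trans h2
  have h3₁ : s₁.reg 3 = k := (hf₁.1 3 (by decide)).trans h3
  have h11₁ : s₁.real 11 0 0 = 0 := by rw [hrest 11 (by decide), h11]
  have hA : Agrees val Z s₁.real := h.congr (hrest 14 (by decide)) (hrest 15 (by decide))
  have hdiff : s₁.real 15 j k ≠ 0 → val t i j k ≠ 0 → val t i j k ≠ s₁.real 15 j k →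
      Run ∅ {10, 14, 15} (.op (.realZero ⟨14, 9, 9⟩)) 1 s₁ (Agrees val (insert (t, i, j, k) Z)) := by
    intro hm h0 hne
    refine Run.realOp _ ⟨14, 9, 9⟩ 0 rfl (by simp) (hA.insert_of_ne hm h0 hne ?_ ?_)
    · simp [setReal_real, hz₁]
    · funext x y
      simp [setReal_real]
  refine Run.ite (k := 4) (fun hb => ?_) fun hb => ?_
  · simp only [Test.Holds, Store.getReal, hz₁, h10, h11₁, nonpos_iff_eq_zero] at hb
    exact (run_skip (by simp) (hA.insert_of_zero hb)).weaken subset_rfl subset_rfl (by omega)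
  simp only [Test.Holds, Store.getReal, hz₁, h10, h11₁, nonpos_iff_eq_zero] at hb
  refine Run.ite (k := 3) (fun hb' => ?_) fun hb' => ?_
  · simp only [Test.Holds, Store.getReal, hz₁, h2₁, h3₁, h11₁, nonpos_iff_eq_zero] at hb'
    refine (Run.realOp _ ⟨15, 2, 3⟩ (val t i j k) ?_ (by simp)
      (hA.insert_of_new hb' hb ?_ ?_ ?_)).weaken subset_rfl subset_rfl (by omega)
    · simp only [Instr.apply, Store.getReal, hz₁, h10]
    · simp [setReal_real]
    · simp [setReal_real, h2₁, h3₁]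
    · intro x y hxy
      rw [setReal_real, if_neg]
      simpa [h2₁, h3₁] using hxy
  simp only [Test.Holds, Store.getReal, hz₁, h2₁, h3₁, h11₁, nonpos_iff_eq_zero] at hb'
  refine Run.ite (k := 2) (fun hle => ?_) fun hle => ?_
  · simp only [Test.Holds, Store.getReal, hz₁, h2₁, h3₁, h10] at hle
    refine Run.ite (k := 1) (fun hge => ?_) fun hge => ?_
    · simp only [Test.Holds, Store.getReal, hz₁, h2₁, h3₁, h10] at hge
      exact run_skip (by simp) (hA.insert_of_eq (le_antisymm hle hge))
    · simp only [Test.Holds, Store.getReal, hz₁, h2₁, h3₁, h10] at hge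
      exact hdiff hb' hb fun he => hge he.ge
  · simp only [Test.Holds, Store.getReal, hz₁, h2₁, h3₁, h10] at hle
    exact (hdiff hb' hb fun he => hle he.le).weaken subset_rfl subset_rfl (by omega)

/-- The quadruples `(t, i, j, k)` in the rounds before `(T, I, J, K)` with `lamHat A i ≠ 0`. -/
def seen (A : Matrix (Fin n) (Fin n) ℝ≥0) (T I J K : ℕ) : Set (ℕ × Fin n × Fin n × Fin n) :=
  {p | lamHat A p.2.1 ≠ 0 ∧ (p.1 < T ∨ p.1 = T ∧ ((p.2.1 : ℕ) < I ∨ (p.2.1 : ℕ) = I ∧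
    ((p.2.2.1 : ℕ) < J ∨ (p.2.2.1 : ℕ) = J ∧ (p.2.2.2 : ℕ) < K)))}

theorem seen_succ_col (hi : lamHat A i ≠ 0) :
    seen A t i j (k + 1) = insert (t, i, j, k) (seen A t i j k) := by
  ext ⟨t', i', j', k'⟩
  simp only [seen, Set.mem_ofPred_eq, Set.mem_insert_iff, Prod.mk.injEq, Fin.ext_iff]
  constructor
  · rintro ⟨h, h'⟩
    by_cases he : t' = t ∧ (i' : ℕ) = i ∧ (j' : ℕ) = j ∧ (k' : ℕ) = k
    · exact Or.inl he
    · exact Or.inr ⟨h, by omega⟩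
  · rintro (⟨rfl, hi', hj', hk'⟩ | ⟨h, h'⟩)
    · exact ⟨(Fin.ext hi' : i' = i) ▸ hi, by omega⟩
    · exact ⟨h, by omega⟩

theorem seen_succ_middle {T I J : ℕ} : seen A T I (J + 1) 0 = seen A T I J n := by
  ext ⟨t', i', j', k'⟩
  simp only [seen, Set.mem_ofPred_eq]
  refine and_congr_right fun _ => ?_
  have := k'.2
  omega

theorem seen_succ_row {T I : ℕ} : seen A T (I + 1) 0 0 = seen A T I n 0 := by
  ext ⟨t', i', j', k'⟩
  simp only [seen, Set.mem_ofPred_eq]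
  refine and_congr_right fun _ => ?_
  have := j'.2
  omega

theorem seen_succ_row_of_zero (hi : lamHat A i = 0) :
    seen A t (i + 1) 0 0 = seen A t i 0 0 := by
  ext ⟨t', i', j', k'⟩
  simp only [seen, Set.mem_ofPred_eq]
  refine and_congr_right fun h => ?_
  have : (i' : ℕ) ≠ i := fun he => h ((Fin.ext he : i' = i) ▸ hi)
  omega

theorem seen_succ {T : ℕ} : seen A (T + 1) 0 0 0 = seen A T n 0 0 := by
  ext ⟨t', i', j', k'⟩
  simp only [seen, Set.mem_ofPred_eq]
  refine and_congr_right fun _ => ?_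
  have := i'.2
  omega

/-- Check the array `6`. -/
def Prog.checkMat : Prog :=
  .forLoop 1 0 (.ite (.realLe ⟨4, 1, 9⟩ ⟨11, 9, 9⟩) .skip
    (.forLoop 2 0 (.forLoop 3 0 .checkEntry)))

/-- Number of operations of `Prog.checkMat`. -/
def checkMatCost (n : ℕ) : ℕ := forCost n (1 + forCost n (forCost n 6))

theorem run_checkMat (hn : s.reg 0 = n) (hz : s.reg 9 = 0) (h11 : ∀ x y, s.real 11 x y = 0)
    (h4 : ∀ i : Fin n, s.real 4 i 0 = lamHat A i)
    (hval : ∀ i j k : Fin n, max (s.real 6 i j) (s.real 6 i k) = val t i j k)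
    (h : Agrees val (seen A t 0 0 0) s.real) :
    Run {1, 2, 3} {10, 14, 15} .checkMat (checkMatCost n) s (Agrees val (seen A (t + 1) 0 0 0)) := by
  rw [seen_succ]
  refine Run.forLoop (R := {2, 3}) hn (by decide) (by decide)
    (fun x => Agrees val (seen A t x 0 0)) h ?_
  intro x hx s₁ hf₁ hx₁ h₁
  have hn₁ : s₁.reg 0 = n := (hf₁.1 0 (by decide)).trans hn
  have hz₁ : s₁.reg 9 = 0 := (hf₁.1 9 (by decide)).trans hz
  have hlam : Test.Holds (.realLe ⟨4, 1, 9⟩ ⟨11, 9, 9⟩) s₁ ↔ lamHat A ⟨x, hx⟩ = 0 := by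
    simp only [Test.Holds, Store.getReal, hz₁, hx₁]
    rw [hf₁.2 4 (by decide), hf₁.2 11 (by decide), h11, ← nonpos_iff_eq_zero, ← h4 ⟨x, hx⟩]
  refine Run.ite (fun hb => ?_) fun hb => ?_
  · refine (run_skip (by simp) ?_).weaken subset_rfl subset_rfl
      (show 1 ≤ forCost n (forCost n 6) by unfold forCost; omega)
    have := seen_succ_row_of_zero (t := t) (hlam.1 hb)
    simp only at this
    rwa [this]
  · rw [seen_succ_row]
    refine Run.forLoop (R := {3}) hn₁ (by decide) (by decide)
      (fun y => Agrees val (seen A t x y 0)) h₁ ?_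
    intro y hy s₂ hf₂ hy₂ h₂
    have hn₂ : s₂.reg 0 = n := (hf₂.1 0 (by decide)).trans hn₁
    rw [seen_succ_middle]
    refine Run.forLoop (R := ∅) hn₂ (by decide) (by decide)
      (fun z => Agrees val (seen A t x y z)) h₂ ?_
    intro z hz' s₃ hf₃ hz₃ h₃
    have hf := hf₁.trans ((hf₂.mono (R' := {1, 2, 3}) (by decide) subset_rfl).trans
      (hf₃.mono (R' := {1, 2, 3}) (by decide) subset_rfl))
    have := seen_succ_col (t := t) (j := ⟨y, hy⟩) (k := ⟨z, hz'⟩) (fun h0 => hb (hlam.2 h0))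
    simp only at this
    rw [this]
    refine run_checkEntry ((hf.1 9 (by decide)).trans hz) ?_ ?_ hz₃ ?_ ?_ h₃
    · exact (hf₃.1 1 (by decide)).trans ((hf₂.1 1 (by decide)).trans hx₁)
    · exact (hf₃.1 2 (by decide)).trans hy₂
    · rw [hf.2 11 (by decide)]; exact h11
    · rw [hf.2 6 (by decide)]; exact hval ⟨x, hx⟩ ⟨y, hy⟩ ⟨z, hz'⟩

/-- Check the matrices of the walks of `n` consecutive lengths. -/
def Prog.checkPhase : Prog :=
  .seq (.op (.realOne ⟨14, 9, 9⟩)) (.forLoop 4 0 (.seq .checkMat (.pairMul 16 17)))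

/-- Number of operations of `Prog.checkPhase`. -/
def checkCost (n : ℕ) : ℕ := 1 + forCost n (checkMatCost n + pairCost n)

theorem run_checkPhase {T : ℕ} (hn : s.reg 0 = n) (hz : s.reg 9 = 0)
    (h11 : ∀ x y, s.real 11 x y = 0) (h15 : ∀ x y, s.real 15 x y = 0)
    (h4 : ∀ i : Fin n, s.real 4 i 0 = lamHat A i) (h5 : Rep (s.real 5) (reach A T))
    (h6 : Rep (s.real 6) (best A T)) (h16 : Rep (s.real 16) (reach A 1))
    (h17 : Rep (s.real 17) (best A 1)) :
    Run {1, 2, 3, 4} {5, 6, 7, 8, 10, 14, 15} .checkPhase (checkCost n) s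
      fun m => m 14 0 0 ≠ 0 ↔ BestAgree A T := by
  let val : ℕ → Fin n → Fin n → Fin n → ℝ≥0 := fun t i j k =>
    max (best A (T + t) i j) (best A (T + t) i k)
  refine Run.seq (Run.realOp _ ⟨14, 9, 9⟩ 1 rfl (by simp)
    (Q := fun m => m 14 0 0 = 1 ∧ ∀ a, a ≠ 14 → m a = s.real a) ⟨?_, ?_⟩) fun s₁ hf₁ h₁ => ?_
  · simp [setReal_real, hz]
  · intro a ha
    funext x y
    simp [setReal_real, ha]
  have hn₁ : s₁.reg 0 = n := (hf₁.1 0 (by decide)).trans hn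
  have hz₁ : s₁.reg 9 = 0 := (hf₁.1 9 (by decide)).trans hz
  refine (Run.forLoop (R := {1, 2, 3}) (D := {5, 6, 7, 8, 10, 14, 15}) hn₁ (by decide) (by decide)
    -- The arrays 16 and 17 keep the pair for length 1, and multiplying by it passes from T + t to T
    -- + t + 1.
    (fun t m => (Rep (m 5) (reach A (T + t)) ∧ Rep (m 6) (best A (T + t))) ∧
      Agrees val (seen A t 0 0 0) m) ⟨⟨?_, ?_⟩, ?_⟩ ?_).mono (by decide) (by decide) le_rfl ?_
  · rw [h₁.2 5 (by decide)]; exact h5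
  · rw [h₁.2 6 (by decide)]; exact h6
  · have h15₁ : ∀ x y, s₁.real 15 x y = 0 := by rw [h₁.2 15 (by decide)]; exact h15
    have hempty : ∀ p, p ∉ seen A 0 0 0 0 := by
      rintro ⟨t, i, j, k⟩ ⟨-, h⟩
      simp only at h
      omega
    refine ⟨fun t i j k _ h => absurd h (hempty _), fun j k h => absurd (h15₁ j k) h, ?_⟩
    rw [h₁.1]
    exact ⟨fun _ t i j k h => absurd h (hempty _), fun _ => one_ne_zero⟩
  · rintro t ht s₂ hf₂ - ⟨⟨h5₂, h6₂⟩, hA⟩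
    have hn₂ : s₂.reg 0 = n := (hf₂.1 0 (by decide)).trans hn₁
    have hz₂ : s₂.reg 9 = 0 := (hf₂.1 9 (by decide)).trans hz₁
    have hkeep : ∀ a, a ∉ ({5, 6, 7, 8, 10, 14, 15} : Finset ℕ) → s₂.real a = s.real a :=
      fun a ha => (hf₂.2 a ha).trans (h₁.2 a fun h => ha (by simp [h]))
    refine Run.seq ((run_checkMat (val := val) hn₂ hz₂ ?_ ?_ ?_ hA).mono (by decide) (by decide)
      le_rfl (Q' := fun m => Agrees val (seen A (t + 1) 0 0 0) m ∧
        ∀ a, a ≠ 10 → a ≠ 14 → a ≠ 15 → m a = s₂.real a)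
      fun s' hf h => ⟨h, fun a h10 h14 h15 => hf.2 a (by simp [h10, h14, h15])⟩) fun s₃ hf₃ h₃ => ?_
    · rw [hkeep 11 (by decide)]; exact h11
    · rw [hkeep 4 (by decide)]; exact h4
    · intro i j k
      rw [h6₂, h6₂]
    have hn₃ : s₃.reg 0 = n := (hf₃.1 0 (by decide)).trans hn₂
    refine (run_pairMul (A := A) (x := T + t) (y := 1) hn₃ (by decide) (by decide) ?_ ?_ ?_ ?_).mono
      (by decide) (by decide) le_rfl fun s' hf h =>
        ⟨h, h₃.1.congr (hf.2 14 (by decide)) (hf.2 15 (by decide))⟩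
    · rw [h₃.2 5 (by decide) (by decide) (by decide)]; exact h5₂
    · rw [h₃.2 6 (by decide) (by decide) (by decide)]; exact h6₂
    · rw [h₃.2 16 (by decide) (by decide) (by decide), hkeep 16 (by decide)]; exact h16
    · rw [h₃.2 17 (by decide) (by decide) (by decide), hkeep 17 (by decide)]; exact h17
  · rintro s₂ - ⟨-, hA⟩
    rw [hA.flag_iff, BestAgree]
    have hmem : ∀ t i j k, (t, i, j, k) ∈ seen A n 0 0 0 ↔ lamHat A i ≠ 0 ∧ t < n := by
      intro t i j k
      simp only [seen, Set.mem_ofPred_eq]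
      exact and_congr_right fun _ => by omega
    simp only [hmem]
    exact ⟨fun h j k i i' s s' hs hs' hi hi' => h j k i i' s s' ⟨hi, hs⟩ ⟨hi', hs'⟩,
      fun h j k i i' s s' hi hi' => h j k i i' s s' hi.2 hi'.2 hi.1 hi'.1⟩

/-- The program that decides whether a matrix is orbit periodic. -/
def Prog.decideOrbitPeriodic : Prog :=
  .seq (.seq .lamPhase (.seq .initPhase (.seq .squarePhase .checkPhase)))
    (.ite (.realLe ⟨14, 9, 9⟩ ⟨11, 9, 9⟩) (.op (.zero 0)) (.seq (.op (.zero 0)) (.op (.succ 0))))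

/-- Bound for the number of operations of `Prog.decideOrbitPeriodic`. -/
def totalCost (n : ℕ) : ℕ :=
  lamCost n + (initCost n + (squareCost n + checkCost n)) + 3

theorem two_mul_sq_le (n : ℕ) : 2 * n ^ 2 ≤ 8 ^ n := by
  have h1 : 2 * n ^ 2 ≤ 2 * (2 ^ n) ^ 2 := by
    have := Nat.lt_two_pow_self (n := n)
    gcongr
  rcases Nat.eq_zero_or_pos n with rfl | hn
  · simp
  · calc 2 * n ^ 2 ≤ 2 * (2 ^ n) ^ 2 := h1
      _ = 2 ^ (1 + n * 2) := by rw [pow_add, pow_mul, pow_one]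
      _ ≤ 2 ^ (3 * n) := Nat.pow_le_pow_right (by norm_num) (by omega)
      _ = 8 ^ n := by rw [pow_mul]; norm_num

theorem run_main (A : Matrix (Fin n) (Fin n) ℝ≥0) :
    Run {1, 2, 3, 4, 5, 6} {1, 2, 4, 5, 6, 7, 8, 10, 12, 13, 14, 15, 16, 17}
      (.seq .lamPhase (.seq .initPhase (.seq .squarePhase .checkPhase)))
      (lamCost n + (initCost n + (squareCost n + checkCost n))) (inputStore A)
      fun m => m 14 0 0 ≠ 0 ↔ OrbitPeriodic A := by
  rw [orbitPeriodic_iff_ratesAgree, ratesAgree_iff_bestAgree (two_mul_sq_le n)]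
  set s := inputStore A with hs
  have hn : s.reg 0 = n := rfl
  -- Register 9 and array 11 are never written: the former addresses scalar cells at (0, 0), the
  -- latter supplies the constant 0 for tests.
  have hz : s.reg 9 = 0 := rfl
  have h0 : ∀ a, a ≠ 0 → ∀ x y, s.real a x y = 0 := fun a ha x y => dif_neg fun h => ha h.1
  have hA : Rep (s.real 0) A := fun i j => dif_pos ⟨rfl, i.2, j.2⟩
  refine Run.seq ((run_lamPhase hn hz hA (h0 4 (by decide))).mono (by decide) (by decide) le_rfl
    (Q' := fun m => (∀ i : Fin n, m 4 i 0 = lamHat A i) ∧ m 0 = s.real 0 ∧ m 11 = s.real 11 ∧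
      m 15 = s.real 15) fun s' hf h => ⟨h, hf.2 0 (by decide), hf.2 11 (by decide),
        hf.2 15 (by decide)⟩) fun s₁ hf₁ h₁ => ?_
  obtain ⟨h4₁, h0₁, h11₁, h15₁⟩ := h₁
  have hn₁ : s₁.reg 0 = n := (hf₁.1 0 (by decide)).trans hn
  have hz₁ : s₁.reg 9 = 0 := (hf₁.1 9 (by decide)).trans hz
  refine Run.seq ((run_initPhase hn₁ hz₁ (h0₁ ▸ hA) h4₁ (h11₁ ▸ h0 11 (by decide))).mono
    (by decide) (by decide) le_rfl (Q' := fun m => ((Rep (m 16) (reach A 1) ∧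
      Rep (m 17) (best A 1)) ∧ Rep (m 5) (reach A 1) ∧ Rep (m 6) (best A 1)) ∧
      m 4 = s₁.real 4 ∧ m 11 = s₁.real 11 ∧ m 15 = s₁.real 15) fun s' hf h =>
        ⟨h, hf.2 4 (by decide), hf.2 11 (by decide), hf.2 15 (by decide)⟩) fun s₂ hf₂ h₂ => ?_
  obtain ⟨⟨⟨h16₂, h17₂⟩, h5₂, h6₂⟩, h4₂, h11₂, h15₂⟩ := h₂
  have hn₂ : s₂.reg 0 = n := (hf₂.1 0 (by decide)).trans hn₁
  have hz₂ : s₂.reg 9 = 0 := (hf₂.1 9 (by decide)).trans hz₁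
  refine Run.seq ((run_squarePhase hn₂ h5₂ h6₂).mono (by decide) (by decide) le_rfl
    (Q' := fun m => (Rep (m 5) (reach A (8 ^ n)) ∧ Rep (m 6) (best A (8 ^ n))) ∧
      m 4 = s₂.real 4 ∧ m 11 = s₂.real 11 ∧ m 15 = s₂.real 15 ∧ m 16 = s₂.real 16 ∧
      m 17 = s₂.real 17) fun s' hf h => ⟨h, hf.2 4 (by decide), hf.2 11 (by decide),
        hf.2 15 (by decide), hf.2 16 (by decide), hf.2 17 (by decide)⟩) fun s₃ hf₃ h₃ => ?_
  obtain ⟨⟨h5₃, h6₃⟩, h4₃, h11₃, h15₃, h16₃, h17₃⟩ := h₃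
  refine (run_checkPhase ((hf₃.1 0 (by decide)).trans hn₂) ((hf₃.1 9 (by decide)).trans hz₂)
    ?_ ?_ ?_ h5₃ h6₃ (h16₃ ▸ h16₂) (h17₃ ▸ h17₂)).weaken (by decide) (by decide) le_rfl
  · rw [h11₃, h11₂, h11₁]; exact h0 11 (by decide)
  · rw [h15₃, h15₂, h15₁]; exact h0 15 (by decide)
  · rw [h4₃, h4₂]; exact h4₁

theorem exec_decideOrbitPeriodic (A : Matrix (Fin n) (Fin n) ℝ≥0) :
    ∃ t s, Exec .decideOrbitPeriodic (inputStore A) t s ∧ s.Answers (OrbitPeriodic A) ∧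
      t ≤ totalCost n := by
  obtain ⟨t, s, he, ht, hf, hs⟩ := run_main A
  have hz : s.reg 9 = 0 := hf.1 9 (by decide)
  have h11 : s.real 11 0 0 = 0 := by
    rw [hf.2 11 (by decide)]
    simp [inputStore]
  have htest : Test.Holds (.realLe ⟨14, 9, 9⟩ ⟨11, 9, 9⟩) s ↔ ¬ OrbitPeriodic A := by
    simp only [Test.Holds, Store.getReal, hz, h11, nonpos_iff_eq_zero, ← hs, not_not]
  by_cases hb : Test.Holds (.realLe ⟨14, 9, 9⟩ ⟨11, 9, 9⟩) s
  · exact ⟨_, _, he.seq (.iteTrue hb (.op _ _)), Or.inr ⟨htest.1 hb, rfl⟩, by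
      unfold totalCost; omega⟩
  · exact ⟨_, _, he.seq (.iteFalse hb (.seq (.op _ _) (.op _ _))),
      Or.inl ⟨not_not.1 fun h => hb (htest.2 h), rfl⟩, by unfold totalCost; omega⟩

theorem totalCost_le (hn : 1 ≤ n) : totalCost n ≤ 1000 * n ^ 4 := by
  have h1 : n ^ 1 ≤ n ^ 4 := Nat.pow_le_pow_right hn (by norm_num)
  have h2 : n ^ 2 ≤ n ^ 4 := Nat.pow_le_pow_right hn (by norm_num)
  have h3 : n ^ 3 ≤ n ^ 4 := Nat.pow_le_pow_right hn (by norm_num)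
  have h0 : 1 ≤ n ^ 4 := Nat.one_le_pow _ _ hn
  rw [pow_one] at h1
  -- The cost is a polynomial of degree four in n; for n ≥ 1 each monomial is at most n⁴, and 1000
  -- generously bounds the sum of the coefficients.
  simp only [totalCost, lamCost, initCost, squareCost, checkCost, checkMatCost, pairCost, matCost,
    forCost]
  ring_nf
  linarith

end Check
end MaxAlg

theorem corollary7p7 :
    ∃ (P : MaxAlg.Prog) (K : ℝ), ∀ (n : ℕ) (A : Matrix (Fin n) (Fin n) ℝ≥0),
      ∃ (t : ℕ) (s : MaxAlg.Store),
        MaxAlg.Exec P (MaxAlg.inputStore A) t s ∧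
        s.Answers (MaxAlg.OrbitPeriodic A) ∧
        (2 ≤ n → (t : ℝ) ≤ K * ((n : ℝ) ^ 4 * Real.log n)) := by
  -- The program needs at most 1000·n⁴ operations; for n ≥ 2 the factor log n / log 2 is at least 1.
  refine ⟨.decideOrbitPeriodic, 1000 / Real.log 2, fun n A => ?_⟩
  obtain ⟨t, s, he, ha, ht⟩ := MaxAlg.exec_decideOrbitPeriodic A
  refine ⟨t, s, he, ha, fun hn => ?_⟩
  have h2 : 0 < Real.log 2 := Real.log_pos (by norm_num)
  have hlog : Real.log 2 ≤ Real.log n := Real.log_le_log (by norm_num) (by exact_mod_cast hn)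
  have ht' : (t : ℝ) ≤ 1000 * (n : ℝ) ^ 4 := by
    exact_mod_cast ht.trans (MaxAlg.totalCost_le (by omega))
  refine ht'.trans ?_
  rw [div_mul_eq_mul_div, le_div_iff₀ h2, ← mul_assoc]
  exact mul_le_mul_of_nonneg_left hlog (by positivity)
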